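/- Let $D^2\subset\mathbb C$ be the closed unit disk with polar coordinates $(r,\theta)$ and area form $\omega=r\,dr\wedge d\theta$. For $i=1,2$ let $\{\phi_i^t\}$, with $\phi_i^0=\mathrm{id}$, be the smooth isotopy of area preserving diffeomorphisms of $D^2$ generated by a smooth Hamiltonian $F_i\colon D^2\times\mathbb R\to\mathbb R$ that is one-periodic in $t$ and has support in $\{r\le r_0\}$ for some $r_0<1$; that is, $\frac{d}{dt}\phi_i^t=X_{F_{i,t}}\circ\phi_i^t$ with $\iota_{X_{F_{i,t}}}\omega=dF_{i,t}$. Let $\phi_i=\phi_i^1$ be the time-one map, and let $$\mathrm{Cal}(\phi_i)=\int_0^1\int_{D^2}F_t\,\omega\,dt$$ be its Calabi invariant, where $F$ is any smooth Hamiltonian, compactly supported in the interior of $D^2$, that generates an isotopy from the identity to $\phi_i$ (the value depends only on $\phi_i$). Let $S^3\subset\mathbb C^2$ be the unit sphere with Hopf coordinates $z_1=e^{i\xi_1}\sin\eta$, $z_2=e^{i\xi_2}\cos\eta$, oriented as the boundary of the unit ball, and let $dV$ be its standard volume form (of total volume $2\pi^2$). Let $\tau^1,\tau^2\colon D^2\times\mathbb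 R/\mathbb Z\to S^3$ be the embeddings given in the coordinates $(\eta,\xi_1,\xi_2)$ by $$\tau^1((r,\theta),t)=\left(\arcsin\tfrac{r}{\sqrt2},\ \theta+2\pi t,\ 2\pi t\right),\qquad \tau^2((r,\theta),t)=\left(\tfrac{\pi}{2}-\arcsin\tfrac{r}{\sqrt2},\ 2\pi t,\ \theta+2\pi t\right),$$ whose images are the solid tori $\{\eta\le\pi/4\}$ and $\{\eta\ge\pi/4\}$. The double suspension $X(\{\phi_1^t\},\{\phi_2^t\})$ is the vector field on $S^3$ that equals $\tau^i_*\left(X_{F_{i,t}}+\frac{\partial}{\partial t}\right)$ on the image of $\tau^i$, $i=1,2$. Then $X=X(\{\phi_1^t\},\{\phi_2^t\})$ is an exact divergence-free vector field on $S^3$, i.e. $\iota_X dV=d\beta$ for some smooth one-form $\beta$ on $S^3$, and its helicity $\mathcal H(X)=\int_{S^3}\beta\wedge d\beta$ with respect to $dV$, which is the same for every such $\beta$, equals $$\mathcal H\left(X(\{\phi_1^t\},\{\phi_2^t\})\right)=2\pi^2\left(\mathrm{Cal}(\phi_1)+\mathrm{Cal}(\phi_2)+2\pi^2\right).$$ 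-/

import Mathlib

open scoped ContDiff
open MeasureTheory

noncomputable section

namespace DoubleSuspension

/-! ### Hamiltonian isotopies of the disk

The unit disk `D²` is the closed unit ball of `ℂ`, with area form `ω = dx ∧ dy = r dr ∧ dθ`.
Functions on `D²` with compact support in the interior are extended by zero to `ℂ`, and maps of
`D²` that are the identity near the boundary are extended by the identity to `ℂ`. -/

/-- The standard area form `ω = dx ∧ dy`. -/
def areaForm (u v : ℂ) : ℝ := u.re * v.im - u.im * v.re

/-- The Hamiltonian vector field `X_f` of `f`, with the sign convention `ι_{X_f} ω = df`
(see `areaForm_hamVF`). -/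
def hamVF (f : ℂ → ℝ) (x : ℂ) : ℂ := ⟨fderiv ℝ f x Complex.I, -(fderiv ℝ f x 1)⟩

theorem areaForm_hamVF (f : ℂ → ℝ) (x v : ℂ) : areaForm (hamVF f x) v = fderiv ℝ f x v := by
  have hv : v = v.re • (1 : ℂ) + v.im • Complex.I := by
    apply Complex.ext <;> simp
  conv_rhs => rw [hv, map_add, map_smul, map_smul]
  simp only [areaForm, hamVF, smul_eq_mul]
  ring

/-- A smooth Hamiltonian isotopy `{φ_t}` in `Diff(D², ∂D², ω)` starting at the identity, together
with the smooth Hamiltonian function `F` that generates it and is normalized by having compact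
support in the interior of the disk. -/
structure HamiltonianIsotopy where
  /-- the maps `φ_t` -/
  φ : ℝ → ℂ → ℂ
  /-- the Hamiltonian functions `F_t` -/
  F : ℝ → ℂ → ℝ
  smooth_φ : ContDiff ℝ ∞ (fun q : ℝ × ℂ => φ q.1 q.2)
  smooth_F : ContDiff ℝ ∞ (fun q : ℝ × ℂ => F q.1 q.2)
  support_F : ∃ r : ℝ, r < 1 ∧ ∀ (t : ℝ) (x : ℂ), r ≤ ‖x‖ → F t x = 0
  bijective : ∀ t, Function.Bijective (φ t)
  area_preserving : ∀ t x, (fderiv ℝ (φ t) x).det = 1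
  φ_zero : ∀ x, φ 0 x = x
  generates : ∀ t x, HasDerivAt (fun s => φ s x) (hamVF (F t) (φ t x)) t

namespace HamiltonianIsotopy

/-- The generating Hamiltonian function is one-periodic in time. -/
def IsOnePeriodic (Φ : HamiltonianIsotopy) : Prop := ∀ t x, Φ.F (t + 1) x = Φ.F t x

/-- The time-one map of the isotopy. -/
def timeOne (Φ : HamiltonianIsotopy) : ℂ → ℂ := Φ.φ 1

/-- The integral `∫₀¹ ∫_{D²} F_t ω dt`. -/
def hamIntegral (Φ : HamiltonianIsotopy) : ℝ :=
  ∫ t in (0 : ℝ)..1, ∫ x in Metric.closedBall (0 : ℂ) 1, Φ.F t x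

/-- The suspension `X({φ_t}) = X_{F_t} + ∂/∂t` of the isotopy, a vector field on `D² × ℝ`
(on `D² × ℝ/ℤ` if the Hamiltonian is one-periodic). -/
def suspension (Φ : HamiltonianIsotopy) (q : ℂ × ℝ) : ℂ × ℝ := (hamVF (Φ.F q.2) q.1, 1)

end HamiltonianIsotopy

open Classical in
/-- The Calabi invariant `Cal(φ) = ∫₀¹ ∫_{D²} F_t ω dt` of a diffeomorphism `φ` of the disk, where
`F` is the normalized Hamiltonian function of an isotopy from the identity to `φ`. It is a function
of `φ` alone (and has the value `0` on maps that are not the end of such an isotopy). -/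
def calabi (φ : ℂ → ℂ) : ℝ :=
  if h : ∃ Φ : HamiltonianIsotopy, Φ.timeOne = φ then h.choose.hamIntegral else 0

/-! ### The three-sphere, forms and helicity -/

/-- The space `ℝ⁴ = ℂ²` with coordinates `(x₁, y₁, x₂, y₂)`. -/
abbrev R4 : Type := EuclideanSpace ℝ (Fin 4)

/-- The unit three-sphere. -/
abbrev S3 : Type := Metric.sphere (0 : R4) 1

/-- `z₁ = x₁ + i y₁`. -/
def z₁ (p : R4) : ℂ := ⟨p 0, p 1⟩

/-- `z₂ = x₂ + i y₂`. -/
def z₂ (p : R4) : ℂ := ⟨p 2, p 3⟩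

/-- The point of `ℝ⁴` with given complex coordinates. -/
def mk (a b : ℂ) : R4 := !₂[a.re, a.im, b.re, b.im]

/-- The standard volume form `dV` of the three-sphere at `p`: the contraction of the determinant
with the outward unit normal `p`. -/
def dV (p u v w : R4) : ℝ := (Matrix.of ![⇑p, ⇑u, ⇑v, ⇑w]).det

/-- The vector fields `e₁, e₂, e₃` form a positively oriented orthonormal frame of `S³`
(see `dV_frame`). -/
def e₁ (p : R4) : R4 := !₂[-p 1, p 0, -p 3, p 2]

/-- Second vector field of the frame. -/
def e₂ (p : R4) : R4 := !₂[-p 2, p 3, p 0, -p 1]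

/-- Third vector field of the frame. -/
def e₃ (p : R4) : R4 := !₂[-p 3, -p 2, p 1, p 0]

theorem dV_frame (p : S3) : dV p (e₁ p) (e₂ p) (e₃ p) = 1 := by
  have h : (p : R4) 0 ^ 2 + (p : R4) 1 ^ 2 + (p : R4) 2 ^ 2 + (p : R4) 3 ^ 2 = 1 := by
    have h1 := mem_sphere_zero_iff_norm.1 p.2
    have h2 := EuclideanSpace.norm_sq_eq (p : R4)
    simp only [h1, Fin.sum_univ_four, Real.norm_eq_abs, sq_abs] at h2
    linarith
  have : dV p (e₁ p) (e₂ p) (e₃ p)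
      = ((p : R4) 0 ^ 2 + (p : R4) 1 ^ 2 + (p : R4) 2 ^ 2 + (p : R4) 3 ^ 2) ^ 2 := by
    simp [dV, e₁, e₂, e₃, Matrix.det_succ_row_zero, Fin.sum_univ_succ, Fin.succAbove]
    ring
  rw [this, h, one_pow]

/-- The integral over the oriented sphere `S³` of the three-form `σ`. Since `e₁, e₂, e₃` is a
positively oriented orthonormal frame, `σ = σ(e₁, e₂, e₃) dV`; the measure of `dV` is the surface
measure `volume.toSphere`. -/
def integralS3 (σ : R4 → R4 → R4 → R4 → ℝ) : ℝ :=
  ∫ p : S3, σ p (e₁ p) (e₂ p) (e₃ p) ∂(volume : Measure R4).toSphere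

/-- The three-form `β ∧ dβ` for a one-form `β`. -/
def wedgeD (β : R4 → R4 [⋀^Fin 1]→L[ℝ] ℝ) (p u v w : R4) : ℝ :=
  β p ![u] * extDeriv β p ![v, w] - β p ![v] * extDeriv β p ![u, w]
    + β p ![w] * extDeriv β p ![u, v]

/-- `β` is a smooth one-form on `S³` (the restriction of a one-form that is smooth around `S³` in
`ℝ⁴`, as every smooth one-form on `S³` is) with `dβ = ι_X dV` on `S³`. -/
structure IsPrimitive (X : S3 → R4) (β : R4 → R4 [⋀^Fin 1]→L[ℝ] ℝ) : Prop where
  smooth : ∀ p : S3, ContDiffAt ℝ ∞ β p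
  d_eq : ∀ (p : S3) (v w : R4), inner ℝ (p : R4) v = 0 → inner ℝ (p : R4) w = 0 →
    extDeriv β p ![v, w] = dV p (X p) v w

/-- The tangent vector field `X` on `S³` is exact divergence-free with respect to `dV`, and its
helicity `∫ β ∧ dβ`, computed with any primitive `β` of `ι_X dV`, is the number `h`. -/
structure HasHelicity (X : S3 → R4) (h : ℝ) : Prop where
  tangent : ∀ p : S3, inner ℝ (p : R4) (X p) = 0
  exact : ∃ β, IsPrimitive X β
  helicity_eq : ∀ β, IsPrimitive X β → integralS3 (wedgeD β) = h

/-! ### The double suspension -/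

/-- Hopf coordinates: `z₁ = e^{iξ₁} sin η`, `z₂ = e^{iξ₂} cos η`. -/
def hopf (η ξ₁ ξ₂ : ℝ) : R4 :=
  mk (Complex.exp (ξ₁ * Complex.I) * Real.sin η) (Complex.exp (ξ₂ * Complex.I) * Real.cos η)

/-- The first solid torus: in polar coordinates `((r, θ), t)` and Hopf coordinates it is
`(η, ξ₁, ξ₂) = (arcsin (r/√2), θ + 2πt, 2πt)` (see `τ₁_polar`). -/
def τ₁ (q : ℂ × ℝ) : R4 :=
  mk (Complex.exp (2 * Real.pi * q.2 * Complex.I) * (q.1 / Real.sqrt 2))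
    (Complex.exp (2 * Real.pi * q.2 * Complex.I) * Real.sqrt (1 - ‖q.1‖ ^ 2 / 2))

/-- The second solid torus: in polar coordinates `((r, θ), t)` and Hopf coordinates it is
`(η, ξ₁, ξ₂) = (π/2 - arcsin (r/√2), 2πt, θ + 2πt)` (see `τ₂_polar`). -/
def τ₂ (q : ℂ × ℝ) : R4 :=
  mk (Complex.exp (2 * Real.pi * q.2 * Complex.I) * Real.sqrt (1 - ‖q.1‖ ^ 2 / 2))
    (Complex.exp (2 * Real.pi * q.2 * Complex.I) * (q.1 / Real.sqrt 2))

/-- The point `(x, t)` with `τ₁ (x, t) = p`, for `p` in the solid torus `{η ≤ π/4}`, that is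
`‖z₁‖ ≤ ‖z₂‖`, where `-1/2 < t ≤ 1/2`. -/
def τ₁Inv (p : R4) : ℂ × ℝ :=
  (Real.sqrt 2 * z₁ p * (starRingEnd ℂ) (z₂ p) / ‖z₂ p‖, (z₂ p).arg / (2 * Real.pi))

/-- The point `(x, t)` with `τ₂ (x, t) = p`, for `p` in the solid torus `{η ≥ π/4}`, that is
`‖z₂‖ ≤ ‖z₁‖`, where `-1/2 < t ≤ 1/2`. -/
def τ₂Inv (p : R4) : ℂ × ℝ :=
  (Real.sqrt 2 * z₂ p * (starRingEnd ℂ) (z₁ p) / ‖z₁ p‖, (z₁ p).arg / (2 * Real.pi))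

/-- The double suspension `X({φ₁ᵗ}, {φ₂ᵗ})`: the vector field on `S³` that is the push-forward
`τ₁_* X({φ₁ᵗ})` on `{η ≤ π/4}` and the push-forward `τ₂_* X({φ₂ᵗ})` on `{η ≥ π/4}`
(see `doubleSuspension_τ₁` and `doubleSuspension_τ₂`). -/
def doubleSuspension (Φ₁ Φ₂ : HamiltonianIsotopy) (p : S3) : R4 :=
  if ‖z₁ p‖ ≤ ‖z₂ p‖ then fderiv ℝ τ₁ (τ₁Inv p) (Φ₁.suspension (τ₁Inv p))
  else fderiv ℝ τ₂ (τ₂Inv p) (Φ₂.suspension (τ₂Inv p))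

/-! The remaining facts confirm the formulas of this section. -/

theorem sq_sqrt_two : ((Real.sqrt 2 : ℝ) : ℂ) * (Real.sqrt 2 : ℝ) = 2 := by
  rw [← Complex.ofReal_mul, Real.mul_self_sqrt (by norm_num)]
  norm_num

theorem polar_aux {r : ℝ} (h0 : 0 ≤ r) (h1 : r ≤ 1) :
    Real.sin (Real.arcsin (r / Real.sqrt 2)) = r / Real.sqrt 2 ∧
      Real.cos (Real.arcsin (r / Real.sqrt 2)) = Real.sqrt (1 - r ^ 2 / 2) := by
  have h2 : (1 : ℝ) ≤ Real.sqrt 2 := by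
    rw [Real.one_le_sqrt]
    norm_num
  constructor
  · rw [Real.sin_arcsin]
    · have : 0 ≤ r / Real.sqrt 2 := by positivity
      linarith
    · rw [div_le_one (by positivity)]
      linarith
  · rw [Real.cos_arcsin, div_pow, Real.sq_sqrt (by norm_num)]

theorem norm_polar {r : ℝ} (h0 : 0 ≤ r) (θ : ℝ) : ‖(r : ℂ) * Complex.exp (θ * Complex.I)‖ = r := by
  rw [norm_mul, Complex.norm_exp_ofReal_mul_I, mul_one, Complex.norm_real, Real.norm_of_nonneg h0]

theorem τ₁_polar {r : ℝ} (h0 : 0 ≤ r) (h1 : r ≤ 1) (θ t : ℝ) :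
    τ₁ (r * Complex.exp (θ * Complex.I), t)
      = hopf (Real.arcsin (r / Real.sqrt 2)) (θ + 2 * Real.pi * t) (2 * Real.pi * t) := by
  obtain ⟨hs, hc⟩ := polar_aux h0 h1
  simp only [τ₁, hopf, hs, hc, norm_polar h0]
  congr 1
  · push_cast
    rw [add_mul, Complex.exp_add]
    ring
  · push_cast
    ring

theorem τ₂_polar {r : ℝ} (h0 : 0 ≤ r) (h1 : r ≤ 1) (θ t : ℝ) :
    τ₂ (r * Complex.exp (θ * Complex.I), t)
      = hopf (Real.pi / 2 - Real.arcsin (r / Real.sqrt 2)) (2 * Real.pi * t)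
        (θ + 2 * Real.pi * t) := by
  obtain ⟨hs, hc⟩ := polar_aux h0 h1
  simp only [τ₂, hopf, Real.sin_pi_div_two_sub, Real.cos_pi_div_two_sub, hs, hc, norm_polar h0]
  congr 1
  · push_cast
    ring
  · push_cast
    rw [add_mul, Complex.exp_add]
    ring

theorem norm_rot (t : ℝ) : ‖Complex.exp (2 * Real.pi * t * Complex.I)‖ = 1 := by
  have := Complex.norm_exp_ofReal_mul_I (2 * Real.pi * t)
  push_cast at this
  exact this

theorem one_sub_pos {x : ℂ} (hx : ‖x‖ ≤ 1) : 0 < 1 - ‖x‖ ^ 2 / 2 := by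
  nlinarith [norm_nonneg x]

theorem norm_small {x : ℂ} (t : ℝ) :
    ‖Complex.exp (2 * Real.pi * t * Complex.I) * (x / Real.sqrt 2)‖ = ‖x‖ / Real.sqrt 2 := by
  rw [norm_mul, norm_rot, one_mul, norm_div, Complex.norm_real,
    Real.norm_of_nonneg (Real.sqrt_nonneg _)]

theorem norm_big {x : ℂ} (t : ℝ) :
    ‖Complex.exp (2 * Real.pi * t * Complex.I) * Real.sqrt (1 - ‖x‖ ^ 2 / 2)‖
      = Real.sqrt (1 - ‖x‖ ^ 2 / 2) := by
  rw [norm_mul, norm_rot, one_mul, Complex.norm_real, Real.norm_of_nonneg (Real.sqrt_nonneg _)]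

theorem small_le_big {x : ℂ} (hx : ‖x‖ ≤ 1) :
    ‖x‖ / Real.sqrt 2 ≤ Real.sqrt (1 - ‖x‖ ^ 2 / 2) := by
  apply Real.le_sqrt_of_sq_le
  rw [div_pow, Real.sq_sqrt (by norm_num)]
  nlinarith [norm_nonneg x]

theorem inv_aux {x : ℂ} (hx : ‖x‖ ≤ 1) (t : ℝ) (a b : ℂ)
    (ha : a = Complex.exp (2 * Real.pi * t * Complex.I) * (x / Real.sqrt 2))
    (hb : b = Complex.exp (2 * Real.pi * t * Complex.I) * Real.sqrt (1 - ‖x‖ ^ 2 / 2)) :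
    ∃ n : ℤ, ((Real.sqrt 2 * a * (starRingEnd ℂ) b / ‖b‖, b.arg / (2 * Real.pi)) : ℂ × ℝ)
      = (x, t + n) := by
  have hs : 0 < Real.sqrt (1 - ‖x‖ ^ 2 / 2) := Real.sqrt_pos.2 (one_sub_pos hx)
  have hs' : ((Real.sqrt (1 - ‖x‖ ^ 2 / 2) : ℝ) : ℂ) ≠ 0 := by exact_mod_cast hs.ne'
  have h2 : ((Real.sqrt 2 : ℝ) : ℂ) ≠ 0 := by
    exact_mod_cast (Real.sqrt_pos.2 (by norm_num : (0 : ℝ) < 2)).ne'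
  have hnb : ‖b‖ = Real.sqrt (1 - ‖x‖ ^ 2 / 2) := by rw [hb, norm_big]
  have hE : Complex.exp (2 * Real.pi * t * Complex.I)
      * (starRingEnd ℂ) (Complex.exp (2 * Real.pi * t * Complex.I)) = 1 := by
    rw [Complex.mul_conj, Complex.normSq_eq_norm_sq, norm_rot]
    norm_num
  have hexp : Complex.exp (b.arg * Complex.I) = Complex.exp (2 * Real.pi * t * Complex.I) := by
    have h := Complex.norm_mul_exp_arg_mul_I b
    rw [hnb] at h
    apply mul_left_cancel₀ hs'
    rw [h, hb]
    ring
  obtain ⟨n, hn⟩ := Complex.exp_eq_exp_iff_exists_int.1 hexp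
  refine ⟨n, Prod.ext ?_ ?_⟩
  · simp only
    rw [hnb, ha, hb, map_mul, Complex.conj_ofReal]
    generalize ((Real.sqrt (1 - ‖x‖ ^ 2 / 2) : ℝ) : ℂ) = S at hs' ⊢
    field_simp
    linear_combination x * hE
  · have h3 : (b.arg : ℂ) = ((2 * Real.pi * (t + n) : ℝ) : ℂ) := by
      apply mul_right_cancel₀ Complex.I_ne_zero
      rw [hn]
      push_cast
      ring
    have h4 : b.arg = 2 * Real.pi * (t + n) := by exact_mod_cast h3
    simp only [h4]
    field_simp

theorem exp_int (t : ℝ) (n : ℤ) : Complex.exp (2 * Real.pi * ((t + n : ℝ) : ℂ) * Complex.I)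
    = Complex.exp (2 * Real.pi * t * Complex.I) := by
  rw [Complex.exp_eq_exp_iff_exists_int]
  refine ⟨n, ?_⟩
  push_cast
  ring

theorem fderiv_periodic {f : ℂ × ℝ → R4} (n : ℤ) (hf : ∀ x t, f (x, t + n) = f (x, t))
    (x : ℂ) (t : ℝ) : fderiv ℝ f (x, t + n) = fderiv ℝ f (x, t) := by
  have h : (fun q : ℂ × ℝ => f (q + (0, (n : ℝ)))) = f := by
    funext q
    obtain ⟨y, s⟩ := q
    simpa using hf y s
  have h' := fderiv_comp_add_right (𝕜 := ℝ) (f := f) (x := (x, t)) ((0, (n : ℝ)) : ℂ × ℝ)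
  rw [h] at h'
  simpa using h'.symm

theorem suspension_periodic (Φ : HamiltonianIsotopy) (h : Φ.IsOnePeriodic) (x : ℂ) (t : ℝ) (n : ℤ) :
    Φ.suspension (x, t + n) = Φ.suspension (x, t) := by
  have hp : Function.Periodic Φ.F 1 := fun s => funext (h s)
  have := hp.int_mul n t
  rw [mul_one] at this
  simp only [HamiltonianIsotopy.suspension, this]

theorem doubleSuspension_τ₁ (Φ₁ Φ₂ : HamiltonianIsotopy) (h : Φ₁.IsOnePeriodic) {x : ℂ}
    (hx : ‖x‖ ≤ 1) (t : ℝ) (p : S3) (hp : (p : R4) = τ₁ (x, t)) :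
    doubleSuspension Φ₁ Φ₂ p = fderiv ℝ τ₁ (x, t) (Φ₁.suspension (x, t)) := by
  have h1 : z₁ p = Complex.exp (2 * Real.pi * t * Complex.I) * (x / Real.sqrt 2) := by
    rw [hp]
    rfl
  have h2 : z₂ p = Complex.exp (2 * Real.pi * t * Complex.I) * Real.sqrt (1 - ‖x‖ ^ 2 / 2) := by
    rw [hp]
    rfl
  have hle : ‖z₁ p‖ ≤ ‖z₂ p‖ := by
    rw [h1, h2, norm_small, norm_big]
    exact small_le_big hx
  obtain ⟨n, hn⟩ := inv_aux hx t _ _ h1 h2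
  have hinv : τ₁Inv p = (x, t + n) := hn
  rw [doubleSuspension, if_pos hle, hinv, suspension_periodic Φ₁ h, fderiv_periodic]
  intro y s
  simp only [τ₁, exp_int]

/-- The rotation of both complex coordinates by the angle `2πs`. -/
def rot (s : ℝ) (p : R4) : R4 :=
  mk (Complex.exp (2 * Real.pi * s * Complex.I) * z₁ p)
    (Complex.exp (2 * Real.pi * s * Complex.I) * z₂ p)

theorem differentiableAt_mk {a b : ℂ × ℝ → ℂ} {q : ℂ × ℝ} (ha : DifferentiableAt ℝ a q)
    (hb : DifferentiableAt ℝ b q) : DifferentiableAt ℝ (fun q => mk (a q) (b q)) q := by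
  have har : DifferentiableAt ℝ (fun q => (a q).re) q := Complex.reCLM.differentiableAt.comp q ha
  have hai : DifferentiableAt ℝ (fun q => (a q).im) q := Complex.imCLM.differentiableAt.comp q ha
  have hbr : DifferentiableAt ℝ (fun q => (b q).re) q := Complex.reCLM.differentiableAt.comp q hb
  have hbi : DifferentiableAt ℝ (fun q => (b q).im) q := Complex.imCLM.differentiableAt.comp q hb
  rw [differentiableAt_euclidean]
  intro i
  fin_cases i
  · exact har
  · exact hai
  · exact hbr
  · exact hbi

theorem differentiableAt_coords {x : ℂ} (hx : ‖x‖ ≤ 1) (t : ℝ) :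
    DifferentiableAt ℝ (fun q : ℂ × ℝ =>
      Complex.exp (2 * Real.pi * q.2 * Complex.I) * (q.1 / Real.sqrt 2)) (x, t) ∧
    DifferentiableAt ℝ (fun q : ℂ × ℝ =>
      Complex.exp (2 * Real.pi * q.2 * Complex.I) * ((Real.sqrt (1 - ‖q.1‖ ^ 2 / 2) : ℝ) : ℂ))
      (x, t) := by
  have hof : DifferentiableAt ℝ (fun q : ℂ × ℝ => ((q.2 : ℝ) : ℂ)) (x, t) :=
    Complex.ofRealCLM.differentiableAt.comp _ differentiableAt_snd
  have hE : DifferentiableAt ℝ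
      (fun q : ℂ × ℝ => Complex.exp (2 * Real.pi * q.2 * Complex.I)) (x, t) :=
    ((hof.const_mul _).mul_const _).cexp
  have hn : DifferentiableAt ℝ (fun q : ℂ × ℝ => ‖q.1‖ ^ 2) (x, t) :=
    differentiableAt_fst.norm_sq ℝ
  have hsq : DifferentiableAt ℝ (fun q : ℂ × ℝ => Real.sqrt (1 - ‖q.1‖ ^ 2 / 2)) (x, t) :=
    DifferentiableAt.sqrt (by fun_prop) (one_sub_pos hx).ne'
  refine ⟨hE.mul (differentiableAt_fst.mul_const _), hE.mul ?_⟩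
  exact Complex.ofRealCLM.differentiableAt.comp _ hsq

theorem fderiv_time {f : ℂ × ℝ → R4} {x : ℂ} {t : ℝ} (hd : DifferentiableAt ℝ f (x, t))
    (hf : ∀ s, f (x, t + s) = rot s (f (x, t))) :
    fderiv ℝ f (x, t) (0, 1) = deriv (fun s => rot s (f (x, t))) 0 := by
  have h1 : HasDerivAt (fun s : ℝ => ((x, t + s) : ℂ × ℝ)) (0, 1) 0 :=
    (hasDerivAt_const _ _).prodMk ((hasDerivAt_id _).const_add t)
  have hd' : HasFDerivAt f (fderiv ℝ f (x, t)) ((fun s : ℝ => ((x, t + s) : ℂ × ℝ)) 0) := by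
    simpa using hd.hasFDerivAt
  have h2 := (hd'.comp_hasDerivAt (0 : ℝ) h1).deriv
  rw [← h2]
  congr 1
  funext s
  exact hf s

theorem exp_add (t s : ℝ) : Complex.exp (2 * Real.pi * ((t + s : ℝ) : ℂ) * Complex.I)
    = Complex.exp (2 * Real.pi * s * Complex.I) * Complex.exp (2 * Real.pi * t * Complex.I) := by
  rw [← Complex.exp_add]
  congr 1
  push_cast
  ring

theorem fderiv_τ₁_time {x : ℂ} (hx : ‖x‖ ≤ 1) (t : ℝ) :
    fderiv ℝ τ₁ (x, t) (0, 1) = deriv (fun s => rot s (τ₁ (x, t))) 0 := by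
  apply fderiv_time (differentiableAt_mk (differentiableAt_coords hx t).1
    (differentiableAt_coords hx t).2)
  intro s
  simp only [exp_add]
  change _ = mk (_ * (_ * _)) (_ * (_ * _))
  congr 1 <;> exact mul_assoc _ _ _

theorem fderiv_τ₂_time {x : ℂ} (hx : ‖x‖ ≤ 1) (t : ℝ) :
    fderiv ℝ τ₂ (x, t) (0, 1) = deriv (fun s => rot s (τ₂ (x, t))) 0 := by
  apply fderiv_time (differentiableAt_mk (differentiableAt_coords hx t).2
    (differentiableAt_coords hx t).1)
  intro s
  simp only [exp_add]
  change _ = mk (_ * (_ * _)) (_ * (_ * _))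
  congr 1 <;> exact mul_assoc _ _ _

theorem suspension_boundary (Φ : HamiltonianIsotopy) {x : ℂ} (hx : ‖x‖ = 1) (t : ℝ) :
    Φ.suspension (x, t) = (0, 1) := by
  obtain ⟨r, hr, hF⟩ := Φ.support_F
  have hev : Φ.F t =ᶠ[nhds x] fun _ => (0 : ℝ) := by
    have hr' : r < ‖x‖ := by rw [hx]; exact hr
    have : ∀ᶠ y in nhds x, r < ‖y‖ := continuous_norm.continuousAt.eventually (lt_mem_nhds hr')
    filter_upwards [this] with y hy using hF t y hy.le
  have h0 : fderiv ℝ (Φ.F t) x = 0 := by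
    rw [hev.fderiv_eq]
    simp
  simp only [HamiltonianIsotopy.suspension, hamVF, h0]
  simp [Complex.ext_iff]

theorem doubleSuspension_τ₂ (Φ₁ Φ₂ : HamiltonianIsotopy) (h : Φ₂.IsOnePeriodic) {x : ℂ}
    (hx : ‖x‖ ≤ 1) (t : ℝ) (p : S3) (hp : (p : R4) = τ₂ (x, t)) :
    doubleSuspension Φ₁ Φ₂ p = fderiv ℝ τ₂ (x, t) (Φ₂.suspension (x, t)) := by
  have h1 : z₂ p = Complex.exp (2 * Real.pi * t * Complex.I) * (x / Real.sqrt 2) := by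
    rw [hp]
    rfl
  have h2 : z₁ p = Complex.exp (2 * Real.pi * t * Complex.I) * Real.sqrt (1 - ‖x‖ ^ 2 / 2) := by
    rw [hp]
    rfl
  by_cases hle : ‖z₁ p‖ ≤ ‖z₂ p‖
  · have hx1 : ‖x‖ = 1 := by
      rw [h1, h2, norm_small, norm_big] at hle
      have h3 := pow_le_pow_left₀ (Real.sqrt_nonneg _) hle 2
      rw [div_pow, Real.sq_sqrt (one_sub_pos hx).le, Real.sq_sqrt (by norm_num)] at h3
      nlinarith [norm_nonneg x]
    have hs2 : (Real.sqrt 2) ^ 2 = 2 := Real.sq_sqrt (by norm_num)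
    have hs0 : 0 < Real.sqrt 2 := Real.sqrt_pos.2 (by norm_num)
    have hy : ‖(τ₁Inv p).1‖ = 1 := by
      have h4 : ‖z₁ p‖ = ‖x‖ / Real.sqrt 2 := by
        apply le_antisymm
        · rw [← norm_small t, ← h1]
          exact hle
        · rw [h2, norm_big]
          exact small_le_big hx
      have h5 : ‖z₂ p‖ = ‖x‖ / Real.sqrt 2 := by rw [h1, norm_small]
      simp only [τ₁Inv, norm_div, norm_mul, RCLike.norm_conj, Complex.norm_real, h4, h5, hx1,
        Real.norm_of_nonneg hs0.le]
      rw [Real.norm_of_nonneg (by positivity)]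
      field_simp
    have hτ : τ₁ (τ₁Inv p) = p := by
      have hz2 : z₂ p ≠ 0 := by
        rw [← norm_ne_zero_iff, h1, norm_small, hx1]
        positivity
      have hz2' : (‖z₂ p‖ : ℂ) ≠ 0 := by exact_mod_cast norm_ne_zero_iff.2 hz2
      have hs2' : ((Real.sqrt 2 : ℝ) : ℂ) ≠ 0 := by exact_mod_cast hs0.ne'
      have hE : Complex.exp (2 * Real.pi * ((τ₁Inv p).2 : ℂ) * Complex.I) = z₂ p / ‖z₂ p‖ := by
        rw [eq_div_iff hz2', mul_comm]
        have h6 := Complex.norm_mul_exp_arg_mul_I (z₂ p)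
        rw [← h6]
        congr 2
        · rw [h6]
        · simp only [τ₁Inv]
          push_cast
          have : (Real.pi : ℂ) ≠ 0 := by exact_mod_cast Real.pi_ne_zero
          field_simp
      have hb : Real.sqrt (1 - ‖(τ₁Inv p).1‖ ^ 2 / 2) = ‖z₂ p‖ := by
        rw [hy, h1, norm_small, hx1, Real.sqrt_eq_iff_mul_self_eq (by norm_num) (by positivity)]
        field_simp
        linarith
      have hm : (p : R4) = mk (z₁ p) (z₂ p) := by
        ext i
        fin_cases i <;> rfl
      rw [τ₁, hE, hb]
      conv_rhs => rw [hm]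
      congr 1
      · have h7 : z₂ p * (starRingEnd ℂ) (z₂ p) = (‖z₂ p‖ : ℂ) ^ 2 := Complex.mul_conj' _
        simp only [τ₁Inv]
        field_simp
        linear_combination z₁ p * h7
      · field_simp
    obtain ⟨y, s, hys⟩ : ∃ y s, τ₁Inv p = (y, s) := ⟨_, _, rfl⟩
    rw [hys] at hy hτ
    rw [doubleSuspension, if_pos hle, hys, suspension_boundary Φ₁ hy, suspension_boundary Φ₂ hx1,
      fderiv_τ₁_time hy.le, fderiv_τ₂_time hx, hτ, hp]
  · obtain ⟨n, hn⟩ := inv_aux hx t _ _ h1 h2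
    have hinv : τ₂Inv p = (x, t + n) := hn
    rw [doubleSuspension, if_neg hle, hinv, suspension_periodic Φ₂ h, fderiv_periodic]
    intro y s
    simp only [τ₂, exp_int]

end DoubleSuspension

end

noncomputable section

namespace DoubleSuspension

/-! ### The Calabi invariant does not depend on the isotopy -/

section Slices

variable {E : Type*} [NormedAddCommGroup E] [NormedSpace ℝ E]

/-! Write `λ = (x dy - y dx)/2`, so `dλ = ω`. The map `τ₁` pulls `dV` back to `π ω ∧ dt`, and the
contraction of this form with the suspension `X_F + ∂/∂t` is `π (ω + dF ∧ dt)`, the differential of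
`π (λ + (2π + F) dt)`. That one-form is the pullback of `π (α + F dt)`, with `α` the standard
contact form. By symmetry `β = π (α + F₁ dt₁ + F₂ dt₂)` is a primitive of `ι_X dV` on the whole
sphere; it is smooth because each `Fᵢ` vanishes near the boundary of its solid torus
(`isPrimitive_primitive`).

For a primitive, `β ∧ dβ = β(X) dV` (`wedgeD_frame`). On the first solid torus `β(X) = π (2π + L₁)`
with `L₁ = F₁ + λ(X_{F₁})`, and similarly on the second. Integration by parts in the plane gives `∫
λ(X_F) ω = ∫ F ω`, hence `∫ L ω = 2 ∫ F ω` (`integral_lagrangian`). With volume `2π²` for the sphere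
and the Jacobian factor `π` of `τ₁` (`integral_solidTorus`), the integral is `2π² · 2π² + 2π² ∫∫ F₁
+ 2π² ∫∫ F₂`.

Two independence statements complete the argument. The helicity does not depend on the primitive: if
`dβ = dγ` on the sphere, then `∫ β ∧ dβ = ∫ β ∧ dγ = ∫ γ ∧ dβ = ∫ γ ∧ dγ`, the middle equality being
Stokes for `β ∧ γ`. Stokes is reduced to the vanishing of the integral of a derivative along a
rotation field (`integral_fderiv_rotation`).

The Calabi invariant depends only on the time-one map: the action `A(x) = ∫₀¹ L_t(φ_t x) dt`
satisfies `dA = φ^*λ - λ` and vanishes far out, so `φ` determines `A`; and `∫ A ω = 2 ∫∫ F ω dt`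
since `φ_t` preserves area (`action_congr`, `integral_action`). -/

theorem hasFDerivAt_slice {G : ℝ × ℂ → E} {t : ℝ} {x : ℂ} (hG : DifferentiableAt ℝ G (t, x)) :
    HasFDerivAt (fun y => G (t, y)) ((fderiv ℝ G (t, x)).comp (.inr ℝ ℝ ℂ)) x :=
  hG.hasFDerivAt.comp x (hasFDerivAt_prodMk_right t x)

theorem fderiv_slice {G : ℝ × ℂ → E} {t : ℝ} {x : ℂ} (hG : DifferentiableAt ℝ G (t, x)) (v : ℂ) :
    fderiv ℝ (fun y => G (t, y)) x v = fderiv ℝ G (t, x) (0, v) := by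
  rw [(hasFDerivAt_slice hG).fderiv]
  simp

theorem hasDerivAt_slice {G : ℝ × ℂ → E} {t : ℝ} {x : ℂ} (hG : DifferentiableAt ℝ G (t, x)) :
    HasDerivAt (fun s => G (s, x)) (fderiv ℝ G (t, x) (1, 0)) t := by
  have h := (hG.hasFDerivAt.comp t (hasFDerivAt_prodMk_left t x)).hasDerivAt
  simpa [Function.comp_def] using h

theorem contDiff_fderiv_apply {G : ℝ × ℂ → E} (hG : ContDiff ℝ ∞ G) (w : ℝ × ℂ) :
    ContDiff ℝ ∞ fun q => fderiv ℝ G q w :=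
  (hG.fderiv_right (m := ∞) (by simp)).clm_apply contDiff_const

/-- The derivative in time of the differential in space. -/
theorem hasDerivAt_fderiv_slice {G : ℝ × ℂ → E} (hG : ContDiff ℝ ∞ G) (t : ℝ) (x v : ℂ) :
    HasDerivAt (fun s => fderiv ℝ G (s, x) (0, v))
      (fderiv ℝ (fun y => fderiv ℝ G (t, y) (1, 0)) x v) t := by
  have h1 : DifferentiableAt ℝ (fderiv ℝ G) (t, x) :=
    (hG.fderiv_right (m := ∞) (by simp)).differentiable (by simp) _
  have hsymm : IsSymmSndFDerivAt ℝ G (t, x) :=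
    hG.contDiffAt.isSymmSndFDerivAt (n := ∞) (by simp; exact WithTop.coe_le_coe.2 le_top)
  have h2 : ∀ w, DifferentiableAt ℝ (fun q => fderiv ℝ G q w) (t, x) := fun w =>
    h1.clm_apply (differentiableAt_const _)
  have h3 : ∀ w u, fderiv ℝ (fun q => fderiv ℝ G q w) (t, x) u
      = fderiv ℝ (fderiv ℝ G) (t, x) u w := by
    intro w u
    rw [fderiv_clm_apply h1 (differentiableAt_const _)]
    simp
  have h4 := hasDerivAt_slice (h2 (0, v))
  -- Symmetry of the second derivative exchanges the time and space directions.
  rw [h3, hsymm, ← h3] at h4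
  rwa [fderiv_slice (h2 (1, 0))]

end Slices

theorem hamVF_eq (f : ℂ → ℝ) (x : ℂ) :
    hamVF f x = (fderiv ℝ f x Complex.I : ℂ) - (fderiv ℝ f x 1 : ℂ) * Complex.I := by
  apply Complex.ext <;> simp [hamVF]

theorem areaForm_swap (u v : ℂ) : areaForm u v = -areaForm v u := by
  simp only [areaForm]
  ring

theorem contDiff_areaForm : ContDiff ℝ ∞ fun q : ℂ × ℂ => areaForm q.1 q.2 := by
  have hr : ContDiff ℝ ∞ Complex.re := Complex.reCLM.contDiff
  have hi : ContDiff ℝ ∞ Complex.im := Complex.imCLM.contDiff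
  unfold areaForm
  fun_prop

theorem hasDerivAt_areaForm {u v : ℝ → ℂ} {u' v' : ℂ} {t : ℝ} (hu : HasDerivAt u u' t)
    (hv : HasDerivAt v v' t) :
    HasDerivAt (fun s => areaForm (u s) (v s)) (areaForm u' (v t) + areaForm (u t) v') t := by
  have hur : HasDerivAt (fun s => (u s).re) u'.re t :=
    Complex.reCLM.hasFDerivAt.comp_hasDerivAt t hu
  have hui : HasDerivAt (fun s => (u s).im) u'.im t :=
    Complex.imCLM.hasFDerivAt.comp_hasDerivAt t hu
  have hvr : HasDerivAt (fun s => (v s).re) v'.re t :=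
    Complex.reCLM.hasFDerivAt.comp_hasDerivAt t hv
  have hvi : HasDerivAt (fun s => (v s).im) v'.im t :=
    Complex.imCLM.hasFDerivAt.comp_hasDerivAt t hv
  refine ((hur.mul hvi).sub (hui.mul hvr)).congr_deriv ?_
  simp only [areaForm]
  ring

theorem differentiableAt_areaForm {u v : ℂ → ℂ} {x : ℂ} (hu : DifferentiableAt ℝ u x)
    (hv : DifferentiableAt ℝ v x) : DifferentiableAt ℝ (fun y => areaForm (u y) (v y)) x :=
  DifferentiableAt.comp (g := fun q : ℂ × ℂ => areaForm q.1 q.2) x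
    ((contDiff_areaForm.differentiable (by simp)) (u x, v x)) (hu.prodMk hv)

theorem fderiv_areaForm {u v : ℂ → ℂ} {x : ℂ} (hu : DifferentiableAt ℝ u x)
    (hv : DifferentiableAt ℝ v x) (w : ℂ) :
    fderiv ℝ (fun y => areaForm (u y) (v y)) x w
      = areaForm (fderiv ℝ u x w) (v x) + areaForm (u x) (fderiv ℝ v x w) := by
  have hline : ∀ {f : ℂ → ℂ}, DifferentiableAt ℝ f x →
      HasDerivAt (fun s : ℝ => f (x + s • w)) (fderiv ℝ f x w) 0 := by
    intro f hf
    exact hf.hasFDerivAt.hasLineDerivAt w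
  have h := hasDerivAt_areaForm (hline hu) (hline hv)
  have hd : DifferentiableAt ℝ (fun y => areaForm (u y) (v y)) x :=
    differentiableAt_areaForm hu hv
  have h' : HasDerivAt (fun s : ℝ => areaForm (u (x + s • w)) (v (x + s • w))) _ 0 :=
    hd.hasFDerivAt.hasLineDerivAt w
  simpa using h'.unique h

theorem contDiff_hamVF {F : ℝ → ℂ → ℝ} (hF : ContDiff ℝ ∞ fun q : ℝ × ℂ => F q.1 q.2) :
    ContDiff ℝ ∞ fun q : ℝ × ℂ => hamVF (F q.1) q.2 := by
  have h : (fun q : ℝ × ℂ => hamVF (F q.1) q.2) = fun q =>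
      ((fderiv ℝ (fun q : ℝ × ℂ => F q.1 q.2) q (0, Complex.I) : ℝ) : ℂ)
        - ((fderiv ℝ (fun q : ℝ × ℂ => F q.1 q.2) q (0, 1) : ℝ) : ℂ) * Complex.I := by
    funext q
    rw [hamVF_eq, ← fderiv_slice (hF.differentiable (by simp) _),
      ← fderiv_slice (hF.differentiable (by simp) _)]
  rw [h]
  have hof : ContDiff ℝ ∞ (fun r : ℝ => (r : ℂ)) := Complex.ofRealCLM.contDiff
  exact (hof.comp (contDiff_fderiv_apply hF _)).sub
    ((hof.comp (contDiff_fderiv_apply hF _)).mul contDiff_const)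

/-- The contraction of `X_f` with the primitive `(x dy - y dx) / 2` of `ω` has the same integral
as `f`. -/
theorem integral_areaForm_hamVF {f : ℂ → ℝ} (hf : ContDiff ℝ 1 f) (hc : HasCompactSupport f) :
    ∫ x, areaForm x (hamVF f x) / 2 = ∫ x, f x := by
  have hf' : Continuous (fderiv ℝ f) := hf.continuous_fderiv (by simp)
  have hfd : ∀ x, DifferentiableAt ℝ f x := hf.differentiable (by simp)
  have hcd : ∀ v, HasCompactSupport fun x => fderiv ℝ f x v := fun v =>
    hc.fderiv_apply ℝ v
  -- Integration by parts in the direction `v`; it is applied to `x ∂ₓf` and `y ∂ᵧf`, each of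
  -- integral `-∫ f`. The two together cancel the factor `-1/2` in `λ(X_f)`.
  have hparts : ∀ (l : ℂ →L[ℝ] ℝ) (v : ℂ), l v = 1 →
      Integrable (fun x => l x * fderiv ℝ f x v) ∧ ∫ x, l x * fderiv ℝ f x v = -∫ x, f x := by
    intro l v hlv
    have hl : ∀ x, fderiv ℝ (fun x => l x) x v = 1 := fun x => by
      rw [ContinuousLinearMap.fderiv, hlv]
    have hi1 : Integrable (fun x => l x * fderiv ℝ f x v) :=
      Continuous.integrable_of_hasCompactSupport (by fun_prop) ((hcd v).mul_left)
    refine ⟨hi1, ?_⟩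
    rw [integral_mul_fderiv_eq_neg_fderiv_mul_of_integrable]
    · simp only [hl, one_mul]
    · simp only [hl, one_mul]
      exact hf.continuous.integrable_of_hasCompactSupport hc
    · exact hi1
    · exact Continuous.integrable_of_hasCompactSupport (l.continuous.mul hf.continuous) hc.mul_left
    · exact fun x _ => l.differentiableAt
    · exact fun x _ => hfd x
  obtain ⟨i1, e1⟩ := hparts Complex.reCLM 1 (by simp)
  obtain ⟨i2, e2⟩ := hparts Complex.imCLM Complex.I (by simp)
  have h : ∀ x, areaForm x (hamVF f x) / 2
      = -(1 / 2) * (Complex.reCLM x * fderiv ℝ f x 1 + Complex.imCLM x * fderiv ℝ f x Complex.I) := by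
    intro x
    simp only [areaForm, hamVF, Complex.reCLM_apply, Complex.imCLM_apply]
    ring
  simp_rw [h]
  rw [integral_const_mul, integral_add i1 i2, e1, e2]
  ring

/-! ### The action of a Hamiltonian isotopy -/

namespace HamiltonianIsotopy

variable (Φ : HamiltonianIsotopy)

/-- The integrand `F + λ(X_F)` of the action, where `λ = (x dy - y dx) / 2`. -/
def lagrangian (t : ℝ) (x : ℂ) : ℝ := Φ.F t x + areaForm x (hamVF (Φ.F t) x) / 2

/-- The action of the trajectory of `x`. -/
def action (x : ℂ) : ℝ := ∫ t in (0 : ℝ)..1, Φ.lagrangian t (Φ.φ t x)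

theorem contDiff_F (t : ℝ) : ContDiff ℝ ∞ (Φ.F t) :=
  Φ.smooth_F.comp (contDiff_prodMk_right t)

theorem contDiff_φ (t : ℝ) : ContDiff ℝ ∞ (Φ.φ t) :=
  Φ.smooth_φ.comp (contDiff_prodMk_right t)

theorem contDiff_lagrangian : ContDiff ℝ ∞ fun q : ℝ × ℂ => Φ.lagrangian q.1 q.2 :=
  Φ.smooth_F.add ((contDiff_areaForm.comp
    (contDiff_snd.prodMk (contDiff_hamVF Φ.smooth_F))).div_const 2)

/-- A radius `r < 1` beyond which everything vanishes. -/
theorem exists_support : ∃ r : ℝ, 0 < r ∧ r < 1 ∧ ∀ (t : ℝ) (x : ℂ), r ≤ ‖x‖ →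
    Φ.F t x = 0 ∧ hamVF (Φ.F t) x = 0 ∧ Φ.lagrangian t x = 0 := by
  obtain ⟨r, hr, hF⟩ := Φ.support_F
  -- The radius is enlarged strictly, so that `F_t` vanishes in a neighbourhood of every point with
  -- `r' ≤ ‖x‖` and its derivative vanishes there as well.
  obtain ⟨r', h1, h2⟩ := exists_between (max_lt hr one_pos)
  refine ⟨r', (le_max_right _ _).trans_lt h1, h2, fun t x hx => ?_⟩
  have hrx : r < ‖x‖ := ((le_max_left _ _).trans_lt h1).trans_le hx
  have hev : Φ.F t =ᶠ[nhds x] fun _ => (0 : ℝ) := by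
    filter_upwards [continuous_norm.continuousAt.eventually (lt_mem_nhds hrx)] with y hy
      using hF t y (le_of_lt hy)
  have h0 : hamVF (Φ.F t) x = 0 := by
    simp [hamVF_eq, hev.fderiv_eq]
  refine ⟨hF t x hrx.le, h0, ?_⟩
  simp [lagrangian, h0, hF t x hrx.le, areaForm]

theorem hasCompactSupport_F (t : ℝ) : HasCompactSupport (Φ.F t) := by
  obtain ⟨r, -, hr, hF⟩ := Φ.exists_support
  refine HasCompactSupport.intro (isCompact_closedBall (0 : ℂ) r) fun x hx => (hF t x ?_).1
  simp only [Metric.mem_closedBall, dist_zero_right, not_le] at hx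
  exact hx.le

theorem setIntegral_closedBall_F (t : ℝ) :
    ∫ x in Metric.closedBall (0 : ℂ) 1, Φ.F t x = ∫ x, Φ.F t x := by
  obtain ⟨r, -, hr, hF⟩ := Φ.exists_support
  refine setIntegral_eq_integral_of_forall_compl_eq_zero fun x hx => (hF t x ?_).1
  simp only [Metric.mem_closedBall, dist_zero_right, not_le] at hx
  exact (hr.trans hx).le

theorem integral_lagrangian (t : ℝ) : ∫ x, Φ.lagrangian t x = 2 * ∫ x, Φ.F t x := by
  have hf : ContDiff ℝ 1 (Φ.F t) := (Φ.contDiff_F t).of_le (by exact_mod_cast le_top)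
  have hc := Φ.hasCompactSupport_F t
  have hX : Continuous fun x => areaForm x (hamVF (Φ.F t) x) / 2 :=
    (((contDiff_areaForm.comp (contDiff_snd.prodMk (contDiff_hamVF Φ.smooth_F))).div_const
      2).continuous).comp (Continuous.prodMk_right t)
  have hXc : HasCompactSupport fun x => areaForm x (hamVF (Φ.F t) x) / 2 := by
    obtain ⟨r, -, hr, hF⟩ := Φ.exists_support
    refine HasCompactSupport.intro (isCompact_closedBall (0 : ℂ) r) fun x hx => ?_
    simp only [Metric.mem_closedBall, dist_zero_right, not_le] at hx
    simp [(hF t x hx.le).2.1, areaForm]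
  simp only [lagrangian]
  rw [integral_add (hf.continuous.integrable_of_hasCompactSupport hc)
    (hX.integrable_of_hasCompactSupport hXc), integral_areaForm_hamVF hf hc]
  ring

/-- Change of variables: `φ_t` is a bijection of the plane with Jacobian one. -/
theorem integral_lagrangian_comp (t : ℝ) :
    ∫ x, Φ.lagrangian t (Φ.φ t x) = ∫ x, Φ.lagrangian t x := by
  have h := integral_image_eq_integral_abs_det_fderiv_smul (s := Set.univ) (f := Φ.φ t)
    (f' := fderiv ℝ (Φ.φ t)) volume MeasurableSet.univ
    (fun x _ => ((Φ.contDiff_φ t).differentiable (by simp) x).hasFDerivAt.hasFDerivWithinAt)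
    (Φ.bijective t).1.injOn (Φ.lagrangian t)
  rw [Set.image_univ, (Φ.bijective t).2.range_eq] at h
  simpa [Φ.area_preserving] using h.symm

/-- The speed of trajectories is bounded, so within time one a point that starts far out cannot
reach the support. This needs no uniqueness theorem for the flow. -/
theorem exists_displacement_bound : ∃ R : ℝ, 0 < R ∧ ∀ t ∈ Set.Icc (0 : ℝ) 1, ∀ x : ℂ, R ≤ ‖x‖ →
    Φ.lagrangian t (Φ.φ t x) = 0 := by
  obtain ⟨r, -, hr, hF⟩ := Φ.exists_support
  obtain ⟨C, hC⟩ := ((isCompact_Icc (a := (0 : ℝ)) (b := 1)).prod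
    (isCompact_closedBall (0 : ℂ) r)).exists_bound_of_continuousOn
    (contDiff_hamVF Φ.smooth_F).continuous.continuousOn
  have hC' : ∀ t ∈ Set.Icc (0 : ℝ) 1, ∀ y, ‖hamVF (Φ.F t) y‖ ≤ max C 0 := by
    intro t ht y
    rcases le_total r ‖y‖ with h | h
    · simp [(hF t y h).2.1]
    · exact (hC (t, y) ⟨ht, by simpa using h⟩).trans (le_max_left _ _)
  -- A displacement of at most `max C 0` leaves the point at norm at least `1`, which exceeds `r`.
  refine ⟨1 + max C 0, by positivity, fun t ht x hx => (hF t _ ?_).2.2⟩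
  have h := norm_image_sub_le_of_norm_deriv_le_segment' (f := fun s => Φ.φ s x)
    (f' := fun s => hamVF (Φ.F s) (Φ.φ s x)) (C := max C 0) (a := 0) (b := 1)
    (fun s _ => (Φ.generates s x).hasDerivWithinAt)
    (fun s hs => hC' s ⟨hs.1, hs.2.le⟩ _) t ht
  rw [Φ.φ_zero, sub_zero] at h
  have h1 : max C 0 * t ≤ max C 0 := mul_le_of_le_one_right (le_max_right _ _) ht.2
  have h2 := norm_sub_norm_le x (Φ.φ t x)
  rw [norm_sub_rev] at h2
  linarith

theorem continuous_lagrangian_flow :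
    Continuous fun q : ℝ × ℂ => Φ.lagrangian q.1 (Φ.φ q.1 q.2) :=
  Φ.contDiff_lagrangian.continuous.comp (continuous_fst.prodMk Φ.smooth_φ.continuous)

/-- Fubini, with area preservation at each fixed time; the factor `2` is that of
`integral_lagrangian`. Integrability holds because the integrand is continuous and vanishes outside
a fixed compact set. -/
theorem integral_action : ∫ x, Φ.action x = 2 * Φ.hamIntegral := by
  obtain ⟨R, -, hR⟩ := Φ.exists_displacement_bound
  have hint : Integrable (Function.uncurry fun t x => Φ.lagrangian t (Φ.φ t x))
      ((volume.restrict (Set.uIoc (0 : ℝ) 1)).prod volume) := by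
    have h1 : IntegrableOn (Function.uncurry fun t x => Φ.lagrangian t (Φ.φ t x))
        (Set.Icc (0 : ℝ) 1 ×ˢ Metric.closedBall (0 : ℂ) R) (volume.prod volume) :=
      Φ.continuous_lagrangian_flow.continuousOn.integrableOn_compact
        (isCompact_Icc.prod (isCompact_closedBall _ _))
    have h2 : IntegrableOn (Function.uncurry fun t x => Φ.lagrangian t (Φ.φ t x))
        (Set.uIoc (0 : ℝ) 1 ×ˢ Set.univ) (volume.prod volume) := by
      refine h1.of_forall_sdiff_eq_zero (measurableSet_uIoc.prod MeasurableSet.univ) ?_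
      rintro ⟨t, x⟩ ⟨⟨ht, -⟩, hx⟩
      rw [Set.uIoc_of_le zero_le_one] at ht
      have ht' : t ∈ Set.Icc (0 : ℝ) 1 := ⟨ht.1.le, ht.2⟩
      refine hR t ht' x ?_
      by_contra hlt
      exact hx ⟨ht', by simpa using (not_le.1 hlt).le⟩
    rwa [IntegrableOn, ← Measure.prod_restrict, Measure.restrict_univ] at h2
  simp only [action]
  rw [← intervalIntegral_integral_swap hint]
  simp_rw [integral_lagrangian_comp, integral_lagrangian, hamIntegral, setIntegral_closedBall_F]
  rw [intervalIntegral.integral_const_mul]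

/-- Cartan's formula for `λ`: the time derivative of `φ_t^*λ` is `φ_t^*(ι_X dλ + d(λ(X)))`, and `ι_X
dλ = dF_t`, so it is the differential of `L_t ∘ φ_t`. -/
theorem hasDerivAt_pullback_primitive (t : ℝ) (x v : ℂ) :
    HasDerivAt (fun s => areaForm (Φ.φ s x) (fderiv ℝ (Φ.φ s) x v) / 2)
      (fderiv ℝ (fun y => Φ.lagrangian t (Φ.φ t y)) x v) t := by
  have hX : DifferentiableAt ℝ (hamVF (Φ.F t)) (Φ.φ t x) :=
    (((contDiff_hamVF Φ.smooth_F).comp (contDiff_prodMk_right t)).differentiable (by simp) _)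
  have hφ : DifferentiableAt ℝ (Φ.φ t) x := (Φ.contDiff_φ t).differentiable (by simp) x
  have hXφ : DifferentiableAt ℝ (fun y => hamVF (Φ.F t) (Φ.φ t y)) x := hX.comp x hφ
  have hF : DifferentiableAt ℝ (Φ.F t) (Φ.φ t x) := (Φ.contDiff_F t).differentiable (by simp) _
  have h1 := hasDerivAt_fderiv_slice Φ.smooth_φ t x v
  have h2 : ∀ y, fderiv ℝ (fun q : ℝ × ℂ => Φ.φ q.1 q.2) (t, y) (1, 0)
      = hamVF (Φ.F t) (Φ.φ t y) := fun y =>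
    (hasDerivAt_slice (Φ.smooth_φ.differentiable (by simp) (t, y))).unique (Φ.generates t y)
  have h3 : ∀ s, fderiv ℝ (fun q : ℝ × ℂ => Φ.φ q.1 q.2) (s, x) (0, v) = fderiv ℝ (Φ.φ s) x v :=
    fun s => (fderiv_slice (Φ.smooth_φ.differentiable (by simp) (s, x)) v).symm
  simp_rw [h2, h3] at h1
  have h4 := (hasDerivAt_areaForm (Φ.generates t x) h1).div_const 2
  refine h4.congr_deriv (Eq.symm ?_)
  have hA : DifferentiableAt ℝ (fun y => areaForm (Φ.φ t y) (hamVF (Φ.F t) (Φ.φ t y))) x :=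
    differentiableAt_areaForm hφ hXφ
  have hFφ : DifferentiableAt ℝ (fun y => Φ.F t (Φ.φ t y)) x := hF.comp x hφ
  have h5 : fderiv ℝ (fun y => Φ.lagrangian t (Φ.φ t y)) x v
      = fderiv ℝ (fun y => Φ.F t (Φ.φ t y)) x v
        + fderiv ℝ (fun y => areaForm (Φ.φ t y) (hamVF (Φ.F t) (Φ.φ t y))) x v / 2 := by
    have := (hFφ.hasFDerivAt.add (hA.hasFDerivAt.mul_const (1 / 2 : ℝ))).fderiv
    have he : (fun y => Φ.lagrangian t (Φ.φ t y)) = (fun y => Φ.F t (Φ.φ t y))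
        + fun y => areaForm (Φ.φ t y) (hamVF (Φ.F t) (Φ.φ t y)) * (1 / 2 : ℝ) := by
      funext y
      simp only [lagrangian, Pi.add_apply]
      ring
    rw [he, this]
    simp
    ring
  have h6 : fderiv ℝ (fun y => Φ.F t (Φ.φ t y)) x v
      = areaForm (hamVF (Φ.F t) (Φ.φ t x)) (fderiv ℝ (Φ.φ t) x v) := by
    rw [areaForm_hamVF]
    have := fderiv_comp x hF hφ
    simp only [Function.comp_def] at this
    rw [this]
    rfl
  rw [h5, h6, fderiv_areaForm hφ hXφ, areaForm_swap (fderiv ℝ (Φ.φ t) x v)]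
  ring

/-- The differential of the action is `φ^* λ - λ`. -/
theorem hasFDerivAt_action (x : ℂ) : ∃ A' : ℂ →L[ℝ] ℝ, HasFDerivAt Φ.action A' x ∧
    ∀ v, A' v = areaForm (Φ.timeOne x) (fderiv ℝ Φ.timeOne x v) / 2 - areaForm x v / 2 := by
  have hsm : ContDiff ℝ ∞ fun q : ℝ × ℂ => Φ.lagrangian q.1 (Φ.φ q.1 q.2) :=
    Φ.contDiff_lagrangian.comp (contDiff_fst.prodMk Φ.smooth_φ)
  have hsm_d := hsm.differentiable (by simp)
  have hfd : Continuous fun q : ℝ × ℂ => fderiv ℝ (fun y => Φ.lagrangian q.1 (Φ.φ q.1 y)) q.2 := by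
    have : (fun q : ℝ × ℂ => fderiv ℝ (fun y => Φ.lagrangian q.1 (Φ.φ q.1 y)) q.2)
        = fun q => (fderiv ℝ (fun q : ℝ × ℂ => Φ.lagrangian q.1 (Φ.φ q.1 q.2)) q).comp
          (.inr ℝ ℝ ℂ) := by
      funext q
      exact (hasFDerivAt_slice (hsm_d (q.1, q.2))).fderiv
    rw [this]
    exact (hsm.continuous_fderiv (by simp)).clm_comp continuous_const
  obtain ⟨C, hC⟩ := ((isCompact_Icc (a := (0 : ℝ)) (b := 1)).prod
    (isCompact_closedBall x 1)).exists_bound_of_continuousOn hfd.continuousOn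
  -- Differentiation under the integral sign; the space derivative is bounded by `C` on the compact
  -- set `[0, 1] × closedBall x 1`.
  have hd : HasFDerivAt Φ.action
      (∫ t in (0 : ℝ)..1, fderiv ℝ (fun y => Φ.lagrangian t (Φ.φ t y)) x) x := by
    refine intervalIntegral.hasFDerivAt_integral_of_dominated_of_fderiv_le (𝕜 := ℝ)
      (F := fun y t => Φ.lagrangian t (Φ.φ t y))
      (F' := fun y t => fderiv ℝ (fun y => Φ.lagrangian t (Φ.φ t y)) y)
      (bound := fun _ => C) (s := Metric.closedBall x 1) (Metric.closedBall_mem_nhds x one_pos)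
      ?_ ?_ ?_ ?_ ?_ ?_
    · exact Filter.Eventually.of_forall fun y =>
        (hsm.continuous.comp (Continuous.prodMk_left y)).aestronglyMeasurable
    · exact (hsm.continuous.comp (Continuous.prodMk_left x)).intervalIntegrable _ _
    · exact (hfd.comp (Continuous.prodMk_left x)).aestronglyMeasurable
    · refine Filter.Eventually.of_forall fun t ht y hy => hC (t, y) ⟨?_, hy⟩
      rw [Set.uIoc_of_le zero_le_one] at ht
      exact ⟨ht.1.le, ht.2⟩
    · exact intervalIntegrable_const
    · refine Filter.Eventually.of_forall fun t _ y _ => ?_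
      exact (hasFDerivAt_slice (hsm_d (t, y))).differentiableAt.hasFDerivAt
  refine ⟨_, hd, fun v => ?_⟩
  rw [ContinuousLinearMap.intervalIntegral_apply
    (φ := fun t => fderiv ℝ (fun y => Φ.lagrangian t (Φ.φ t y)) x)
    ((hfd.comp (Continuous.prodMk_left x)).intervalIntegrable 0 1)]
  -- The integrand is the time derivative of `φ_t^*λ`, so only the endpoints remain: `φ^*λ` at time
  -- one and `λ` at time zero.
  rw [intervalIntegral.integral_eq_sub_of_hasDerivAt
    (fun t _ => Φ.hasDerivAt_pullback_primitive t x v)]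
  · have h0 : Φ.φ 0 = id := funext Φ.φ_zero
    simp [h0, timeOne]
  · exact ((hfd.comp (Continuous.prodMk_left x)).clm_apply
      continuous_const).intervalIntegrable 0 1

theorem action_eq_zero : ∃ R : ℝ, ∀ x : ℂ, R ≤ ‖x‖ → Φ.action x = 0 := by
  obtain ⟨R, -, hR⟩ := Φ.exists_displacement_bound
  refine ⟨R, fun x hx => ?_⟩
  rw [action, intervalIntegral.integral_congr (g := fun _ => 0), intervalIntegral.integral_zero]
  intro t ht
  rw [Set.uIcc_of_le zero_le_one] at ht
  exact hR t ht x hx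

/-- The differential `φ^*λ - λ` sees only the time-one map, so the two actions differ by a constant.
Comparison at a point where both vanish shows that the constant is zero. -/
theorem action_congr {Φ Ψ : HamiltonianIsotopy} (h : Φ.timeOne = Ψ.timeOne) :
    Φ.action = Ψ.action := by
  choose A hA hA' using Φ.hasFDerivAt_action
  choose B hB hB' using Ψ.hasFDerivAt_action
  have hd : ∀ x, HasFDerivAt (fun x => Φ.action x - Ψ.action x) (0 : ℂ →L[ℝ] ℝ) x := by
    intro x
    have hAB : A x - B x = 0 := by
      ext v
      simp [hA', hB', h]
    rw [← hAB]
    exact (hA x).sub (hB x)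
  have hconst := is_const_of_fderiv_eq_zero (𝕜 := ℝ) (fun x => (hd x).differentiableAt)
    (fun x => (hd x).fderiv)
  obtain ⟨R, hR⟩ := Φ.action_eq_zero
  obtain ⟨S, hS⟩ := Ψ.action_eq_zero
  funext x
  have h1 := hconst x ((max |R| |S| : ℝ) : ℂ)
  have h2 : ‖((max |R| |S| : ℝ) : ℂ)‖ = max |R| |S| := by
    rw [Complex.norm_real, Real.norm_of_nonneg (le_max_of_le_left (abs_nonneg R))]
  rw [hR ((max |R| |S| : ℝ) : ℂ) (h2.symm ▸ (le_abs_self R).trans (le_max_left _ _)),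
    hS ((max |R| |S| : ℝ) : ℂ) (h2.symm ▸ (le_abs_self S).trans (le_max_right _ _)),
    sub_zero] at h1
  exact sub_eq_zero.1 h1

theorem hamIntegral_congr {Φ Ψ : HamiltonianIsotopy} (h : Φ.timeOne = Ψ.timeOne) :
    Φ.hamIntegral = Ψ.hamIntegral := by
  have h1 := Φ.integral_action
  rw [action_congr h, Ψ.integral_action] at h1
  linarith

theorem calabi_timeOne : calabi Φ.timeOne = Φ.hamIntegral := by
  have h : ∃ Ψ : HamiltonianIsotopy, Ψ.timeOne = Φ.timeOne := ⟨Φ, rfl⟩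
  rw [calabi, dif_pos h]
  exact hamIntegral_congr h.choose_spec

end HamiltonianIsotopy

/-! ### One-forms -/

section OneForm

variable {E : Type*} [NormedAddCommGroup E] [NormedSpace ℝ E]

/-- Covectors as alternating forms of degree one. -/
def oneForm : (E →L[ℝ] ℝ) ≃ₗᵢ[ℝ] (E [⋀^Fin 1]→L[ℝ] ℝ) :=
  ContinuousAlternatingMap.ofSubsingletonLIE (0 : Fin 1)

@[simp]
theorem oneForm_apply (l : E →L[ℝ] ℝ) (v : Fin 1 → E) : oneForm l v = l (v 0) := rfl

theorem oneForm_symm_apply (β : E [⋀^Fin 1]→L[ℝ] ℝ) (v : E) : oneForm.symm β v = β ![v] := by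
  conv_rhs => rw [← oneForm.apply_symm_apply β]
  rfl

theorem extDeriv_oneForm {B : E → E →L[ℝ] ℝ} {x : E} (hB : DifferentiableAt ℝ B x) (v w : E) :
    extDeriv (fun y => oneForm (B y)) x ![v, w] = fderiv ℝ B x v w - fderiv ℝ B x w v := by
  have hd : DifferentiableAt ℝ (fun y => (oneForm (B y) : E [⋀^Fin 1]→L[ℝ] ℝ)) x :=
    (oneForm (E := E)).differentiable.differentiableAt.comp x hB
  have h : ∀ u u' : E, fderiv ℝ (fun y => B y u) x u' = fderiv ℝ B x u' u := fun u u' => by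
    rw [fderiv_clm_apply hB (differentiableAt_const _)]
    simp
  rw [extDeriv_apply hd]
  simp [Fin.sum_univ_two, Fin.removeNth, h]
  ring

/-- The wedge product of the one-form `β` and the exterior derivative of the one-form `γ`. -/
def wedgeExtDeriv (β γ : R4 → R4 [⋀^Fin 1]→L[ℝ] ℝ) (p u v w : R4) : ℝ :=
  β p ![u] * extDeriv γ p ![v, w] - β p ![v] * extDeriv γ p ![u, w]
    + β p ![w] * extDeriv γ p ![u, v]

end OneForm

/-! ### Integration over the three-sphere -/

/-- The map of the sphere that is induced by a linear isometry. -/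
def sphereMap (T : R4 ≃ₗᵢ[ℝ] R4) (p : S3) : S3 := ⟨T p, by simp⟩

theorem continuous_sphereMap (T : R4 ≃ₗᵢ[ℝ] R4) : Continuous (sphereMap T) :=
  (T.continuous.comp continuous_subtype_val).subtype_mk _

open scoped Pointwise in
-- Up to the factor `4`, the surface measure of a set is the Lebesgue measure of the cone over it in
-- the unit ball; an isometry maps cones to cones and preserves Lebesgue measure.
theorem measurePreserving_sphereMap (T : R4 ≃ₗᵢ[ℝ] R4) :
    MeasurePreserving (sphereMap T) (volume : Measure R4).toSphere
      (volume : Measure R4).toSphere := by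
  have hm : Measurable (sphereMap T) := (continuous_sphereMap T).measurable
  refine ⟨hm, Measure.ext fun s hs => ?_⟩
  rw [Measure.map_apply hm hs, Measure.toSphere_apply' _ hs, Measure.toSphere_apply' _ (hm hs),
    ← T.measurePreserving.measure_preimage_emb T.toHomeomorph.measurableEmbedding
      (Set.Ioo (0 : ℝ) 1 • (Subtype.val '' s))]
  congr 2
  ext x
  simp only [Set.mem_smul, Set.mem_image, Set.mem_preimage]
  constructor
  · rintro ⟨r, hr, _, ⟨p, hp, rfl⟩, rfl⟩
    exact ⟨r, hr, _, ⟨sphereMap T p, hp, rfl⟩, (T.map_smul r (p : R4)).symm⟩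
  · rintro ⟨r, hr, _, ⟨p, hp, rfl⟩, hx⟩
    refine ⟨r, hr, _, ⟨sphereMap T.symm p, ?_, rfl⟩, ?_⟩
    · have : sphereMap T (sphereMap T.symm p) = p := Subtype.ext (T.apply_symm_apply p)
      rwa [this]
    · apply T.injective
      rw [map_smul]
      change r • T (T.symm p) = _
      rw [T.apply_symm_apply]
      exact hx

theorem integral_sphereMap (T : R4 ≃ₗᵢ[ℝ] R4) (g : S3 → ℝ) :
    ∫ p, g (sphereMap T p) ∂(volume : Measure R4).toSphere
      = ∫ p, g p ∂(volume : Measure R4).toSphere := by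
  have hemb : MeasurableEmbedding (sphereMap T) := by
    let e : S3 ≃ₜ S3 :=
      { toFun := sphereMap T
        invFun := sphereMap T.symm
        left_inv := fun p => Subtype.ext (T.symm_apply_apply p)
        right_inv := fun p => Subtype.ext (T.apply_symm_apply p)
        continuous_toFun := continuous_sphereMap T
        continuous_invFun := continuous_sphereMap T.symm }
    exact e.measurableEmbedding
  exact (measurePreserving_sphereMap T).integral_comp hemb g

section Rotation

variable {J : R4 →L[ℝ] R4} (hJ : ∀ p, J (J p) = -p) (hn : ∀ p, ‖J p‖ = ‖p‖)
  (ho : ∀ p, inner ℝ p (J p) = 0)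

theorem norm_rotation {J : R4 →L[ℝ] R4} (hn : ∀ p, ‖J p‖ = ‖p‖) (ho : ∀ p, inner ℝ p (J p) = 0)
    (s : ℝ) (p : R4) : ‖Real.cos s • p + Real.sin s • J p‖ = ‖p‖ := by
  have h : ‖Real.cos s • p + Real.sin s • J p‖ ^ 2 = ‖p‖ ^ 2 := by
    rw [norm_add_sq_real, inner_smul_left, inner_smul_right, ho, norm_smul, norm_smul, hn,
      mul_pow, mul_pow, Real.norm_eq_abs, Real.norm_eq_abs, sq_abs, sq_abs]
    simp only [mul_zero, add_zero]
    rw [← add_mul, Real.cos_sq_add_sin_sq, one_mul]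
  exact (pow_left_inj₀ (norm_nonneg _) (norm_nonneg _) two_ne_zero).1 h

/-- The rotation by the angle `s` along an orthogonal complex structure. -/
def rotationLI {J : R4 →L[ℝ] R4} (hn : ∀ p, ‖J p‖ = ‖p‖) (ho : ∀ p, inner ℝ p (J p) = 0) (s : ℝ) :
    R4 ≃ₗᵢ[ℝ] R4 :=
  LinearIsometry.toLinearIsometryEquiv
    { toLinearMap := (Real.cos s • ContinuousLinearMap.id ℝ R4 + Real.sin s • J : R4 →L[ℝ] R4)
      norm_map' := fun p => norm_rotation hn ho s p } rfl

theorem rotationLI_apply {J : R4 →L[ℝ] R4} (hn : ∀ p, ‖J p‖ = ‖p‖)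
    (ho : ∀ p, inner ℝ p (J p) = 0) (s : ℝ) (p : R4) :
    rotationLI hn ho s p = Real.cos s • p + Real.sin s • J p := rfl

/-- The Lie derivative of a function along a rotation field of the sphere has integral zero. -/
theorem integral_fderiv_rotation {J : R4 →L[ℝ] R4} (hJ : ∀ p, J (J p) = -p)
    (hn : ∀ p, ‖J p‖ = ‖p‖) (ho : ∀ p, inner ℝ p (J p) = 0) {f : R4 → ℝ}
    (hf : ∀ p : S3, ContDiffAt ℝ 1 f p) :
    ∫ p : S3, fderiv ℝ f p (J p) ∂(volume : Measure R4).toSphere = 0 := by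
  set g : S3 → ℝ := fun p => fderiv ℝ f p (J p) with hg
  have hgc : Continuous g := by
    rw [continuous_iff_continuousAt]
    intro p
    have h1 : ContinuousAt (fun q : S3 => fderiv ℝ f q) p :=
      ContinuousAt.comp (f := fun q : S3 => (q : R4)) (x := p)
        ((hf p).continuousAt_fderiv (by simp)) continuous_subtype_val.continuousAt
    exact h1.clm_apply (J.continuous.comp continuous_subtype_val).continuousAt
  have hcont : Continuous (fun q : ℝ × S3 => sphereMap (rotationLI hn ho q.1) q.2) := by
    refine Continuous.subtype_mk ?_ _
    simp only [rotationLI_apply]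
    fun_prop
  have hint : Integrable (Function.uncurry fun s p => g (sphereMap (rotationLI hn ho s) p))
      ((volume.restrict (Set.uIoc 0 (2 * Real.pi))).prod (volume : Measure R4).toSphere) := by
    have hc : Continuous (Function.uncurry fun s p => g (sphereMap (rotationLI hn ho s) p)) :=
      hgc.comp hcont
    have h1 := hc.continuousOn.integrableOn_compact
      (μ := volume.prod (volume : Measure R4).toSphere)
      ((isCompact_uIcc (a := 0) (b := 2 * Real.pi)).prod (isCompact_univ (X := S3)))
    rw [IntegrableOn, ← Measure.prod_restrict, Measure.restrict_univ] at h1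
    exact h1.mono_measure (Measure.prod_mono (Measure.restrict_mono Set.uIoc_subset_uIcc le_rfl)
      le_rfl)
  have hswap := intervalIntegral_integral_swap hint
  simp_rw [integral_sphereMap] at hswap
  -- Along an orbit of the rotation, `g` is the derivative of `f`, and every orbit closes up after
  -- time `2π`. Each rotation preserves the measure, so averaging over the circle leaves `∫ g`
  -- unchanged.
  have hzero : ∀ p : S3, ∫ s in (0 : ℝ)..2 * Real.pi, g (sphereMap (rotationLI hn ho s) p) = 0 := by
    intro p
    have hder : ∀ s : ℝ, HasDerivAt (fun s => f (rotationLI hn ho s p))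
        (g (sphereMap (rotationLI hn ho s) p)) s := by
      intro s
      have h1 : HasDerivAt (fun s => rotationLI hn ho s (p : R4))
          (-Real.sin s • (p : R4) + Real.cos s • J p) s :=
        ((Real.hasDerivAt_cos s).smul_const _).add ((Real.hasDerivAt_sin s).smul_const _)
      have h2 : J (rotationLI hn ho s p) = -Real.sin s • (p : R4) + Real.cos s • J p := by
        rw [rotationLI_apply, map_add, map_smul, map_smul, hJ, smul_neg, neg_smul, add_comm]
      rw [← h2] at h1
      exact ((hf (sphereMap (rotationLI hn ho s) p)).differentiableAt
        (by simp)).hasFDerivAt.comp_hasDerivAt s h1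
    rw [intervalIntegral.integral_eq_sub_of_hasDerivAt (fun s _ => hder s)]
    · simp [rotationLI_apply]
    · exact ((hgc.comp hcont).comp (Continuous.prodMk_left p)).intervalIntegrable _ _
  simp_rw [hzero] at hswap
  simpa [Real.pi_ne_zero] using hswap

end Rotation

/-! ### Stokes' theorem -/

/-- A linear vector field on `ℝ⁴`. -/
def linearField (M : Matrix (Fin 4) (Fin 4) ℝ) : R4 →L[ℝ] R4 := Matrix.toEuclideanCLM (𝕜 := ℝ) M

/-- The field `e₁` as a linear map. -/
def E₁ : R4 →L[ℝ] R4 := linearField !![0, -1, 0, 0; 1, 0, 0, 0; 0, 0, 0, -1; 0, 0, 1, 0]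

/-- The field `e₂` as a linear map. -/
def E₂ : R4 →L[ℝ] R4 := linearField !![0, 0, -1, 0; 0, 0, 0, 1; 1, 0, 0, 0; 0, -1, 0, 0]

/-- The field `e₃` as a linear map. -/
def E₃ : R4 →L[ℝ] R4 := linearField !![0, 0, 0, -1; 0, 0, -1, 0; 0, 1, 0, 0; 1, 0, 0, 0]

theorem E₁_apply (p : R4) : E₁ p = e₁ p := by
  ext i
  fin_cases i <;> simp [E₁, e₁, linearField, Matrix.mulVec, dotProduct, Fin.sum_univ_four]

theorem E₂_apply (p : R4) : E₂ p = e₂ p := by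
  ext i
  fin_cases i <;> simp [E₂, e₂, linearField, Matrix.mulVec, dotProduct, Fin.sum_univ_four]

theorem E₃_apply (p : R4) : E₃ p = e₃ p := by
  ext i
  fin_cases i <;> simp [E₃, e₃, linearField, Matrix.mulVec, dotProduct, Fin.sum_univ_four]

theorem inner_R4 (p q : R4) :
    inner ℝ p q = p 0 * q 0 + p 1 * q 1 + p 2 * q 2 + p 3 * q 3 := by
  simp [PiLp.inner_apply, Fin.sum_univ_four]
  ring

theorem norm_sq_R4 (p : R4) : ‖p‖ ^ 2 = p 0 ^ 2 + p 1 ^ 2 + p 2 ^ 2 + p 3 ^ 2 := by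
  simp [EuclideanSpace.norm_sq_eq, Fin.sum_univ_four]

theorem norm_eq_of_sq {p q : R4}
    (h : p 0 ^ 2 + p 1 ^ 2 + p 2 ^ 2 + p 3 ^ 2 = q 0 ^ 2 + q 1 ^ 2 + q 2 ^ 2 + q 3 ^ 2) :
    ‖p‖ = ‖q‖ := by
  rw [← norm_sq_R4, ← norm_sq_R4] at h
  exact (pow_left_inj₀ (norm_nonneg _) (norm_nonneg _) two_ne_zero).1 h

/-- Each field of the frame is an orthogonal complex structure, hence generates a circle of
isometries. -/
theorem integral_fderiv_frame {f : R4 → ℝ} (hf : ∀ p : S3, ContDiffAt ℝ 1 f p) :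
    ∫ p : S3, fderiv ℝ f p (E₁ p) ∂(volume : Measure R4).toSphere = 0 ∧
    ∫ p : S3, fderiv ℝ f p (E₂ p) ∂(volume : Measure R4).toSphere = 0 ∧
    ∫ p : S3, fderiv ℝ f p (E₃ p) ∂(volume : Measure R4).toSphere = 0 := by
  refine ⟨integral_fderiv_rotation ?_ ?_ ?_ hf, integral_fderiv_rotation ?_ ?_ ?_ hf,
    integral_fderiv_rotation ?_ ?_ ?_ hf⟩
  all_goals
    intro p
    simp only [E₁_apply, E₂_apply, E₃_apply]
    first
    | (ext i; fin_cases i <;> simp [e₁, e₂, e₃])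
    | (apply norm_eq_of_sq; simp [e₁, e₂, e₃]; ring)
    | (rw [inner_R4]; simp [e₁, e₂, e₃]; ring)

/-- The quaternion relations. They supply the terms in which the frame itself is differentiated in
the proof of Stokes' theorem. -/
theorem frame_mul (p : R4) : E₁ (E₂ p) = E₃ p ∧ E₂ (E₁ p) = -E₃ p ∧ E₂ (E₃ p) = E₁ p ∧
    E₃ (E₂ p) = -E₁ p ∧ E₃ (E₁ p) = E₂ p ∧ E₁ (E₃ p) = -E₂ p := by
  simp only [E₁_apply, E₂_apply, E₃_apply]
  refine ⟨?_, ?_, ?_, ?_, ?_, ?_⟩ <;> ext i <;> fin_cases i <;> simp [e₁, e₂, e₃]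

section Stokes

variable {B C : R4 → R4 →L[ℝ] ℝ}

theorem hasFDerivAt_apply_linear {p : R4} (hB : DifferentiableAt ℝ B p) (L : R4 →L[ℝ] R4) :
    HasFDerivAt (fun q => B q (L q)) ((B p).comp L + (fderiv ℝ B p).flip (L p)) p :=
  hB.hasFDerivAt.clm_apply L.hasFDerivAt

/-- The function `(β ∧ γ)(V, W)` for linear vector fields `V` and `W`. -/
def wedgeApply (B C : R4 → R4 →L[ℝ] ℝ) (V W : R4 →L[ℝ] R4) (q : R4) : ℝ :=
  B q (V q) * C q (W q) - B q (W q) * C q (V q)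

theorem contDiffAt_wedgeApply {p : R4} (hB : ContDiffAt ℝ ∞ B p) (hC : ContDiffAt ℝ ∞ C p)
    (V W : R4 →L[ℝ] R4) : ContDiffAt ℝ 1 (wedgeApply B C V W) p := by
  have hB' : ContDiffAt ℝ 1 B p := hB.of_le (WithTop.coe_le_coe.2 le_top)
  have hC' : ContDiffAt ℝ 1 C p := hC.of_le (WithTop.coe_le_coe.2 le_top)
  exact ((hB'.clm_apply V.contDiff.contDiffAt).mul (hC'.clm_apply W.contDiff.contDiffAt)).sub
    ((hB'.clm_apply W.contDiff.contDiffAt).mul (hC'.clm_apply V.contDiff.contDiffAt))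

theorem fderiv_wedgeApply {p : R4} (hB : DifferentiableAt ℝ B p) (hC : DifferentiableAt ℝ C p)
    (V W : R4 →L[ℝ] R4) (u : R4) :
    fderiv ℝ (wedgeApply B C V W) p u
      = B p (V p) * (C p (W u) + fderiv ℝ C p u (W p))
        + C p (W p) * (B p (V u) + fderiv ℝ B p u (V p))
        - (B p (W p) * (C p (V u) + fderiv ℝ C p u (V p))
        + C p (V p) * (B p (W u) + fderiv ℝ B p u (W p))) := by
  have h := (((hasFDerivAt_apply_linear hB V).mul (hasFDerivAt_apply_linear hC W)).sub
    ((hasFDerivAt_apply_linear hB W).mul (hasFDerivAt_apply_linear hC V))).fderiv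
  have he : wedgeApply B C V W = ((fun q => B q (V q)) * fun q => C q (W q))
      - (fun q => B q (W q)) * fun q => C q (V q) := rfl
  rw [he, h]
  simp
  ring

theorem wedgeExtDeriv_frame {p : R4} (hC : DifferentiableAt ℝ C p) :
    wedgeExtDeriv (fun q => oneForm (B q)) (fun q => oneForm (C q)) p (e₁ p) (e₂ p) (e₃ p)
      = B p (E₁ p) * (fderiv ℝ C p (E₂ p) (E₃ p) - fderiv ℝ C p (E₃ p) (E₂ p))
        - B p (E₂ p) * (fderiv ℝ C p (E₁ p) (E₃ p) - fderiv ℝ C p (E₃ p) (E₁ p))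
        + B p (E₃ p) * (fderiv ℝ C p (E₁ p) (E₂ p) - fderiv ℝ C p (E₂ p) (E₁ p)) := by
  simp only [wedgeExtDeriv, ← E₁_apply, ← E₂_apply, ← E₃_apply, extDeriv_oneForm hC,
    oneForm_apply, Matrix.cons_val_zero]

theorem integrable_wedgeExtDeriv (hB : ∀ p : S3, ContDiffAt ℝ ∞ B p)
    (hC : ∀ p : S3, ContDiffAt ℝ ∞ C p) :
    Integrable (fun p : S3 => wedgeExtDeriv (fun q => oneForm (B q)) (fun q => oneForm (C q)) p
      (e₁ p) (e₂ p) (e₃ p)) (volume : Measure R4).toSphere := by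
  have hCd : ∀ p : S3, DifferentiableAt ℝ C p := fun p => (hC p).differentiableAt (by simp)
  have hB0 : Continuous fun p : S3 => B p := by
    rw [continuous_iff_continuousAt]
    exact fun p => ContinuousAt.comp (f := fun q : S3 => (q : R4)) (x := p)
      (hB p).continuousAt continuous_subtype_val.continuousAt
  have hC1 : Continuous fun p : S3 => fderiv ℝ C p := by
    rw [continuous_iff_continuousAt]
    exact fun p => ContinuousAt.comp (f := fun q : S3 => (q : R4)) (x := p)
      ((hC p).continuousAt_fderiv (by simp)) continuous_subtype_val.continuousAt
  simp_rw [wedgeExtDeriv_frame (hCd _)]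
  have hE : ∀ L : R4 →L[ℝ] R4, Continuous fun p : S3 => L p := fun L =>
    L.continuous.comp continuous_subtype_val
  have hBE := fun L => hB0.clm_apply (hE L)
  have hCE := fun L M => (hC1.clm_apply (hE L)).clm_apply (hE M)
  have hc := ((((hBE E₁).mul ((hCE E₂ E₃).sub (hCE E₃ E₂))).sub
    ((hBE E₂).mul ((hCE E₁ E₃).sub (hCE E₃ E₁)))).add
    ((hBE E₃).mul ((hCE E₁ E₂).sub (hCE E₂ E₁))))
  rw [← integrableOn_univ]
  exact hc.continuousOn.integrableOn_compact isCompact_univ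

/-- Stokes' theorem on the three-sphere for the two-form `β ∧ γ`. -/
theorem integralS3_wedgeExtDeriv_comm_oneForm (hB : ∀ p : S3, ContDiffAt ℝ ∞ B p)
    (hC : ∀ p : S3, ContDiffAt ℝ ∞ C p) :
    integralS3 (wedgeExtDeriv (fun q => oneForm (B q)) (fun q => oneForm (C q)))
      = integralS3 (wedgeExtDeriv (fun q => oneForm (C q)) (fun q => oneForm (B q))) := by
  have hBd : ∀ p : S3, DifferentiableAt ℝ B p := fun p => (hB p).differentiableAt (by simp)
  have hCd : ∀ p : S3, DifferentiableAt ℝ C p := fun p => (hC p).differentiableAt (by simp)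
  have hW := fun V W (p : S3) => contDiffAt_wedgeApply (hB p) (hC p) V W
  have hi : ∀ (f : R4 → ℝ) (L : R4 →L[ℝ] R4), (∀ p : S3, ContDiffAt ℝ 1 f p) →
      Integrable (fun p : S3 => fderiv ℝ f p (L p)) (volume : Measure R4).toSphere := by
    intro f L hf
    have h1 : Continuous fun p : S3 => fderiv ℝ f p := by
      rw [continuous_iff_continuousAt]
      exact fun p => ContinuousAt.comp (f := fun q : S3 => (q : R4)) (x := p)
        ((hf p).continuousAt_fderiv (by simp)) continuous_subtype_val.continuousAt
    rw [← integrableOn_univ]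
    exact (h1.clm_apply (L.continuous.comp
      continuous_subtype_val)).continuousOn.integrableOn_compact isCompact_univ
  have h1 := (integral_fderiv_frame (hW E₂ E₃)).1
  have h2 := (integral_fderiv_frame (hW E₃ E₁)).2.1
  have h3 := (integral_fderiv_frame (hW E₁ E₂)).2.2
  have i1 := hi _ E₁ (hW E₂ E₃)
  have i2 := hi _ E₂ (hW E₃ E₁)
  have i3 := hi _ E₃ (hW E₁ E₂)
  -- The identity `d(β ∧ γ) = dβ ∧ γ - β ∧ dγ` on the frame, with the left side as a cyclic sum of
  -- derivatives along `E₁`, `E₂`, `E₃`. The terms from differentiating the frame cancel by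
  -- `frame_mul`.
  have hpt : ∀ p : S3,
      wedgeExtDeriv (fun q => oneForm (C q)) (fun q => oneForm (B q)) p (e₁ p) (e₂ p) (e₃ p)
        - wedgeExtDeriv (fun q => oneForm (B q)) (fun q => oneForm (C q)) p (e₁ p) (e₂ p) (e₃ p)
      = fderiv ℝ (wedgeApply B C E₂ E₃) p (E₁ p) + fderiv ℝ (wedgeApply B C E₃ E₁) p (E₂ p)
        + fderiv ℝ (wedgeApply B C E₁ E₂) p (E₃ p) := by
    intro p
    obtain ⟨f1, f2, f3, f4, f5, f6⟩ := frame_mul p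
    rw [wedgeExtDeriv_frame (hBd p), wedgeExtDeriv_frame (hCd p),
      fderiv_wedgeApply (hBd p) (hCd p), fderiv_wedgeApply (hBd p) (hCd p),
      fderiv_wedgeApply (hBd p) (hCd p), f1, f2, f3, f4, f5, f6]
    simp only [map_neg]
    ring
  have hsum := integral_sub (integrable_wedgeExtDeriv hC hB) (integrable_wedgeExtDeriv hB hC)
  simp_rw [hpt] at hsum
  rw [integral_add (f := fun p : S3 => fderiv ℝ (wedgeApply B C E₂ E₃) p (E₁ p)
    + fderiv ℝ (wedgeApply B C E₃ E₁) p (E₂ p)) (i1.add i2) i3, integral_add i1 i2, h1, h2, h3] at hsum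
  simp only [integralS3]
  linarith

end Stokes

/-! ### Independence of the primitive, and the density of `β ∧ dβ` -/

theorem integralS3_wedgeExtDeriv_comm {β γ : R4 → R4 [⋀^Fin 1]→L[ℝ] ℝ}
    (hβ : ∀ p : S3, ContDiffAt ℝ ∞ β p) (hγ : ∀ p : S3, ContDiffAt ℝ ∞ γ p) :
    integralS3 (wedgeExtDeriv β γ) = integralS3 (wedgeExtDeriv γ β) := by
  have h := integralS3_wedgeExtDeriv_comm_oneForm (B := fun q => oneForm.symm (β q))
    (C := fun q => oneForm.symm (γ q))
    (fun p => (oneForm (E := R4)).symm.contDiff.contDiffAt.comp _ (hβ p))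
    (fun p => (oneForm (E := R4)).symm.contDiff.contDiffAt.comp _ (hγ p))
  simpa only [LinearIsometryEquiv.apply_symm_apply] using h

theorem inner_frame (p : R4) :
    inner ℝ p (e₁ p) = 0 ∧ inner ℝ p (e₂ p) = 0 ∧ inner ℝ p (e₃ p) = 0 := by
  simp only [inner_R4]
  refine ⟨?_, ?_, ?_⟩ <;> simp [e₁, e₂, e₃] <;> ring

/-- The helicity does not depend on the primitive. -/
theorem integralS3_wedgeD_congr {X : S3 → R4} {β γ : R4 → R4 [⋀^Fin 1]→L[ℝ] ℝ}
    (hβ : IsPrimitive X β) (hγ : IsPrimitive X γ) :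
    integralS3 (wedgeD β) = integralS3 (wedgeD γ) := by
  have key : ∀ {β γ δ : R4 → R4 [⋀^Fin 1]→L[ℝ] ℝ}, IsPrimitive X β → IsPrimitive X γ →
      integralS3 (wedgeExtDeriv δ β) = integralS3 (wedgeExtDeriv δ γ) := by
    intro β γ δ hβ hγ
    simp only [integralS3]
    congr 1
    funext p
    obtain ⟨h1, h2, h3⟩ := inner_frame p
    simp only [wedgeExtDeriv, hβ.d_eq p _ _ h1 h2, hβ.d_eq p _ _ h1 h3, hβ.d_eq p _ _ h2 h3,
      hγ.d_eq p _ _ h1 h2, hγ.d_eq p _ _ h1 h3, hγ.d_eq p _ _ h2 h3]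
  calc integralS3 (wedgeExtDeriv β β) = integralS3 (wedgeExtDeriv β γ) := key hβ hγ
    _ = integralS3 (wedgeExtDeriv γ β) := integralS3_wedgeExtDeriv_comm hβ.smooth hγ.smooth
    _ = integralS3 (wedgeExtDeriv γ γ) := key hβ hγ

theorem dV_eq (p u v w : R4) : dV p u v w =
    (p 0 * u 1 - p 1 * u 0) * (v 2 * w 3 - v 3 * w 2)
    - (p 0 * u 2 - p 2 * u 0) * (v 1 * w 3 - v 3 * w 1)
    + (p 0 * u 3 - p 3 * u 0) * (v 1 * w 2 - v 2 * w 1)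
    + (p 1 * u 2 - p 2 * u 1) * (v 0 * w 3 - v 3 * w 0)
    - (p 1 * u 3 - p 3 * u 1) * (v 0 * w 2 - v 2 * w 0)
    + (p 2 * u 3 - p 3 * u 2) * (v 0 * w 1 - v 1 * w 0) := by
  simp [dV, Matrix.det_succ_row_zero, Fin.sum_univ_succ, Fin.succAbove]
  ring

/-- Contraction with two fields of the frame leaves the component along the third. The identities
are polynomial and hold off the sphere, with the factor `‖q‖²`. -/
theorem dV_frame_inner (q u : R4) :
    dV q u (e₂ q) (e₃ q) = (q 0 ^ 2 + q 1 ^ 2 + q 2 ^ 2 + q 3 ^ 2) * inner ℝ u (e₁ q) ∧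
    dV q u (e₁ q) (e₃ q) = (q 0 ^ 2 + q 1 ^ 2 + q 2 ^ 2 + q 3 ^ 2) * -inner ℝ u (e₂ q) ∧
    dV q u (e₁ q) (e₂ q) = (q 0 ^ 2 + q 1 ^ 2 + q 2 ^ 2 + q 3 ^ 2) * inner ℝ u (e₃ q) := by
  simp only [dV_eq, inner_R4]
  refine ⟨?_, ?_, ?_⟩ <;> simp [e₁, e₂, e₃] <;> ring

/-- For a primitive `β` of `ι_X dV` one has `β ∧ dβ = β(X) dV`. -/
theorem wedgeD_frame {X : S3 → R4} {β : R4 → R4 [⋀^Fin 1]→L[ℝ] ℝ} (hβ : IsPrimitive X β)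
    (hX : ∀ p : S3, inner ℝ (p : R4) (X p) = 0) (p : S3) :
    wedgeD β p (e₁ p) (e₂ p) (e₃ p) = β p ![X p] := by
  obtain ⟨h1, h2, h3⟩ := inner_frame p
  simp only [wedgeD, hβ.d_eq p _ _ h1 h2, hβ.d_eq p _ _ h1 h3, hβ.d_eq p _ _ h2 h3]
  have hp : (p : R4) 0 ^ 2 + (p : R4) 1 ^ 2 + (p : R4) 2 ^ 2 + (p : R4) 3 ^ 2 = 1 := by
    rw [← norm_sq_R4, mem_sphere_zero_iff_norm.1 p.2, one_pow]
  have hXp := hX p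
  rw [inner_R4] at hXp
  generalize X p = u at *
  generalize (p : R4) = q at *
  obtain ⟨d1, d2, d3⟩ := dV_frame_inner q u
  rw [hp, one_mul] at d1 d2 d3
  -- The expansion of the vector in the orthonormal frame; there is no component along `q` because
  -- the vector is tangent.
  have hu : u = dV q u (e₂ q) (e₃ q) • e₁ q - dV q u (e₁ q) (e₃ q) • e₂ q
      + dV q u (e₁ q) (e₂ q) • e₃ q := by
    rw [d1, d2, d3]
    simp only [inner_R4]
    ext i
    fin_cases i <;> simp [e₁, e₂, e₃]
    · linear_combination -u 0 * hp + q 0 * hXp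
    · linear_combination -u 1 * hp + q 1 * hXp
    · linear_combination -u 2 * hp + q 2 * hXp
    · linear_combination -u 3 * hp + q 3 * hXp
  conv_rhs => rw [hu]
  simp only [← oneForm_symm_apply]
  simp only [map_add, map_sub, map_smul, smul_eq_mul]
  ring

/-! ### Complex coordinates on `ℝ⁴` -/

@[simp]
theorem z₁_mk (a b : ℂ) : z₁ (mk a b) = a := rfl

@[simp]
theorem z₂_mk (a b : ℂ) : z₂ (mk a b) = b := rfl

@[simp]
theorem mk_z (p : R4) : mk (z₁ p) (z₂ p) = p := by
  ext i
  fin_cases i <;> rfl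

/-- The first complex coordinate as a linear map. -/
def z₁L : R4 →L[ℝ] ℂ :=
  Complex.equivRealProdCLM.symm.toContinuousLinearMap.comp
    ((EuclideanSpace.proj (0 : Fin 4) : R4 →L[ℝ] ℝ).prod (EuclideanSpace.proj (1 : Fin 4)))

/-- The second complex coordinate as a linear map. -/
def z₂L : R4 →L[ℝ] ℂ :=
  Complex.equivRealProdCLM.symm.toContinuousLinearMap.comp
    ((EuclideanSpace.proj (2 : Fin 4) : R4 →L[ℝ] ℝ).prod (EuclideanSpace.proj (3 : Fin 4)))

theorem z₁L_apply (p : R4) : z₁L p = z₁ p := by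
  apply Complex.ext <;> simp [z₁L, z₁]

theorem z₂L_apply (p : R4) : z₂L p = z₂ p := by
  apply Complex.ext <;> simp [z₂L, z₂]

theorem continuous_z₁ : Continuous z₁ := by
  have h : z₁ = z₁L := funext fun p => (z₁L_apply p).symm
  exact h ▸ z₁L.continuous

theorem continuous_z₂ : Continuous z₂ := by
  have h : z₂ = z₂L := funext fun p => (z₂L_apply p).symm
  exact h ▸ z₂L.continuous

theorem norm_sq_eq_z (p : R4) : ‖p‖ ^ 2 = ‖z₁ p‖ ^ 2 + ‖z₂ p‖ ^ 2 := by
  rw [norm_sq_R4, ← Complex.normSq_eq_norm_sq, ← Complex.normSq_eq_norm_sq, Complex.normSq_apply,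
    Complex.normSq_apply]
  simp only [z₁, z₂]
  ring

theorem z₁_smul (r : ℝ) (p : R4) : z₁ (r • p) = r * z₁ p := by
  rw [← z₁L_apply, map_smul, z₁L_apply, Complex.real_smul]

theorem z₂_smul (r : ℝ) (p : R4) : z₂ (r • p) = r * z₂ p := by
  rw [← z₂L_apply, map_smul, z₂L_apply, Complex.real_smul]

theorem smul_mk (r : ℝ) (a b : ℂ) : r • mk a b = mk (r * a) (r * b) := by
  rw [← mk_z (r • mk a b), z₁_smul, z₂_smul, z₁_mk, z₂_mk]

/-- The complex coordinates as an isometry. -/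
def coordIsometry : R4 ≃ₗᵢ[ℝ] WithLp 2 (ℂ × ℂ) where
  toFun p := WithLp.toLp 2 (z₁ p, z₂ p)
  invFun q := mk q.fst q.snd
  left_inv p := mk_z p
  right_inv q := rfl
  map_add' p q := rfl
  map_smul' r p := by
    rw [z₁_smul, z₂_smul]
    simp [← WithLp.toLp_smul]
  norm_map' p := by
    change ‖WithLp.toLp 2 (z₁ p, z₂ p)‖ = ‖p‖
    rw [← pow_left_inj₀ (norm_nonneg _) (norm_nonneg _) two_ne_zero, norm_sq_eq_z,
      WithLp.prod_norm_sq_eq_of_L2]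
    rfl

/-- The complex coordinates as a measurable equivalence. -/
def coordEquiv : R4 ≃ᵐ ℂ × ℂ :=
  coordIsometry.toHomeomorph.toMeasurableEquiv.trans (MeasurableEquiv.toLp 2 (ℂ × ℂ)).symm

theorem measurePreserving_coordEquiv : MeasurePreserving coordEquiv :=
  coordIsometry.measurePreserving.trans (WithLp.volume_preserving_symm_measurableEquiv_toLp_prod ℂ ℂ)

/-! ### Integration over a solid torus -/

theorem det_complex (L : ℂ →L[ℝ] ℂ) :
    L.det = (L 1).re * (L Complex.I).im - (L Complex.I).re * (L 1).im := by
  rw [ContinuousLinearMap.det, ← LinearMap.det_toMatrix Complex.basisOneI, Matrix.det_fin_two]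
  simp [LinearMap.toMatrix_apply]

/-- The map of the disk of radius `√2` onto the plane for which
`(radialMap c x, c)` is on the ray of `τ₁ (x, t)` if `c / ‖c‖ = exp (2πit)`. -/
def radialMap (c x : ℂ) : ℂ := c * ((Real.sqrt (2 - ‖x‖ ^ 2))⁻¹ : ℝ) * x

theorem two_sub_pos {x : ℂ} (hx : x ∈ Metric.ball (0 : ℂ) (Real.sqrt 2)) : 0 < 2 - ‖x‖ ^ 2 := by
  rw [mem_ball_zero_iff] at hx
  have := Real.lt_sqrt (norm_nonneg x) |>.1 hx
  linarith

/-- A map `x ↦ g(‖x‖) x` has Jacobian `g (g + ρ g')` at `ρ = ‖x‖`; here `g = (2 - ρ²)^(-1/2)`, and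
the constant `c` contributes `‖c‖²`. -/
theorem hasFDerivAt_radialMap (c : ℂ) {x : ℂ} (hx : x ∈ Metric.ball (0 : ℂ) (Real.sqrt 2)) :
    ∃ L : ℂ →L[ℝ] ℂ, HasFDerivAt (radialMap c) L x ∧ L.det = ‖c‖ ^ 2 * (2 / (2 - ‖x‖ ^ 2) ^ 2) := by
  have h0 := two_sub_pos hx
  set S := Real.sqrt (2 - ‖x‖ ^ 2) with hS
  have hS0 : 0 < S := Real.sqrt_pos.2 h0
  have hS2 : S ^ 2 = 2 - ‖x‖ ^ 2 := Real.sq_sqrt h0.le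
  have h1 : HasFDerivAt (fun y : ℂ => ‖y‖ ^ 2) (2 • innerSL ℝ x) x :=
    (hasStrictFDerivAt_norm_sq x).hasFDerivAt
  have hg : HasDerivAt (fun s : ℝ => (Real.sqrt (2 - s))⁻¹) (1 / (2 * S ^ 3)) (‖x‖ ^ 2) := by
    have := (((hasDerivAt_id (‖x‖ ^ 2)).const_sub 2).sqrt h0.ne').inv hS0.ne'
    refine this.congr_deriv ?_
    simp only [id, ← hS]
    field_simp
  have h2 : HasFDerivAt (fun y : ℂ => (Real.sqrt (2 - ‖y‖ ^ 2))⁻¹)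
      ((1 / (2 * S ^ 3)) • (2 • innerSL ℝ x)) x :=
    HasDerivAt.comp_hasFDerivAt (h₂ := fun s : ℝ => (Real.sqrt (2 - s))⁻¹) x hg h1
  have h3 := ((Complex.ofRealCLM.hasFDerivAt.comp x h2).const_mul c).mul (hasFDerivAt_id x)
  refine ⟨_, h3, ?_⟩
  have hn : ∀ z : ℂ, ‖z‖ ^ 2 = z.re ^ 2 + z.im ^ 2 := fun z => by
    rw [← Complex.normSq_eq_norm_sq, Complex.normSq_apply]
    ring
  rw [det_complex, ← hS2, hn c]
  rw [hn x] at hS2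
  simp [← hS, Complex.inner, -Complex.ofReal_inv]
  field_simp
  linear_combination S ^ 2 * (c.re ^ 2 + c.im ^ 2) * hS2

/-- The inverse of `radialMap c`. -/
def radialInv (c y : ℂ) : ℂ := ((Real.sqrt (2 / (1 + ‖y / c‖ ^ 2)) : ℝ) : ℂ) * (y / c)

theorem radialMap_radialInv {c : ℂ} (hc : c ≠ 0) (y : ℂ) :
    radialInv c y ∈ Metric.ball (0 : ℂ) (Real.sqrt 2) ∧ radialMap c (radialInv c y) = y := by
  set w := y / c with hw
  have h0 : 0 < 1 + ‖w‖ ^ 2 := by positivity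
  have hn : ‖radialInv c y‖ ^ 2 = 2 / (1 + ‖w‖ ^ 2) * ‖w‖ ^ 2 := by
    rw [radialInv, norm_mul, mul_pow, Complex.norm_real, Real.norm_of_nonneg (Real.sqrt_nonneg _),
      Real.sq_sqrt (by positivity)]
  have h2 : 2 - ‖radialInv c y‖ ^ 2 = 2 / (1 + ‖w‖ ^ 2) := by
    rw [hn]
    field_simp
    ring
  refine ⟨?_, ?_⟩
  · rw [mem_ball_zero_iff, Real.lt_sqrt (norm_nonneg _), ← sub_pos, h2]
    positivity
  · rw [radialMap, h2, radialInv, ← hw, mul_assoc, ← mul_assoc ((_ : ℝ) : ℂ), ← Complex.ofReal_mul,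
      inv_mul_cancel₀ (Real.sqrt_pos.2 (by positivity)).ne', Complex.ofReal_one, one_mul, hw,
      mul_div_cancel₀ _ hc]

theorem radialInv_radialMap {c : ℂ} (hc : c ≠ 0) {x : ℂ}
    (hx : x ∈ Metric.ball (0 : ℂ) (Real.sqrt 2)) : radialInv c (radialMap c x) = x := by
  have h0 := two_sub_pos hx
  set S := Real.sqrt (2 - ‖x‖ ^ 2) with hS
  have hS0 : 0 < S := Real.sqrt_pos.2 h0
  have hS2 : S ^ 2 = 2 - ‖x‖ ^ 2 := Real.sq_sqrt h0.le
  have h1 : radialMap c x / c = (S⁻¹ : ℝ) * x := by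
    rw [radialMap, ← hS, mul_assoc, mul_div_cancel_left₀ _ hc]
  have h2 : 2 / (1 + ‖((S⁻¹ : ℝ) : ℂ) * x‖ ^ 2) = S ^ 2 := by
    rw [norm_mul, Complex.norm_real, Real.norm_of_nonneg (by positivity), mul_pow, inv_pow]
    field_simp
    rw [hS2]
    ring
  rw [radialInv, h1, h2, Real.sqrt_sq hS0.le, ← mul_assoc, ← Complex.ofReal_mul,
    mul_inv_cancel₀ hS0.ne', Complex.ofReal_one, one_mul]

theorem integral_radialMap {c : ℂ} (hc : c ≠ 0) (f : ℂ → ℝ) :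
    ∫ y, f y = ∫ x in Metric.ball (0 : ℂ) (Real.sqrt 2),
      ‖c‖ ^ 2 * (2 / (2 - ‖x‖ ^ 2) ^ 2) * f (radialMap c x) := by
  choose! L hL hdet using fun (x : ℂ) (hx : x ∈ Metric.ball (0 : ℂ) (Real.sqrt 2)) =>
    hasFDerivAt_radialMap c hx
  have himage : radialMap c '' Metric.ball (0 : ℂ) (Real.sqrt 2) = Set.univ :=
    Set.eq_univ_of_forall fun y => ⟨radialInv c y, radialMap_radialInv hc y⟩
  have hinj : Set.InjOn (radialMap c) (Metric.ball (0 : ℂ) (Real.sqrt 2)) :=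
    Set.LeftInvOn.injOn (f₁' := radialInv c) fun x hx => radialInv_radialMap hc hx
  have h := integral_image_eq_integral_abs_det_fderiv_smul volume
    (Metric.isOpen_ball.measurableSet) (fun x hx => (hL x hx).hasFDerivWithinAt) hinj f
  rw [himage, setIntegral_univ] at h
  rw [h]
  refine setIntegral_congr_fun Metric.isOpen_ball.measurableSet fun x hx => ?_
  simp only [hdet x hx, smul_eq_mul]
  rw [abs_of_nonneg]
  positivity

theorem z₁_τ₁ (x : ℂ) (t : ℝ) :
    z₁ (τ₁ (x, t)) = Complex.exp (2 * Real.pi * t * Complex.I) * (x / Real.sqrt 2) := rfl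

theorem z₂_τ₁ (x : ℂ) (t : ℝ) : z₂ (τ₁ (x, t))
    = Complex.exp (2 * Real.pi * t * Complex.I) * Real.sqrt (1 - ‖x‖ ^ 2 / 2) := rfl

theorem norm_τ₁ {x : ℂ} (hx : ‖x‖ ^ 2 ≤ 2) (t : ℝ) : ‖τ₁ (x, t)‖ = 1 := by
  have h : ‖τ₁ (x, t)‖ ^ 2 = 1 := by
    rw [norm_sq_eq_z, z₁_τ₁, z₂_τ₁, norm_small, norm_big, div_pow, Real.sq_sqrt (by norm_num),
      Real.sq_sqrt (by linarith)]
    ring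
  exact (pow_eq_one_iff_of_nonneg (norm_nonneg _) two_ne_zero).1 h

theorem exp_arg {c : ℂ} (hc : c ≠ 0) :
    Complex.exp (2 * Real.pi * ((c.arg / (2 * Real.pi) : ℝ) : ℂ) * Complex.I) = c / ‖c‖ := by
  have hc' : (‖c‖ : ℂ) ≠ 0 := by exact_mod_cast norm_ne_zero_iff.2 hc
  rw [eq_div_iff hc', mul_comm]
  conv_rhs => rw [← Complex.norm_mul_exp_arg_mul_I c]
  congr 3
  push_cast
  have : (Real.pi : ℂ) ≠ 0 := by exact_mod_cast Real.pi_ne_zero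
  field_simp

/-- The point `(radialMap c x, c)` is a multiple of `τ₁ (x, arg c / 2π)`. -/
theorem mk_radialMap {c : ℂ} (hc : c ≠ 0) {x : ℂ} (hx : x ∈ Metric.ball (0 : ℂ) (Real.sqrt 2)) :
    mk (radialMap c x) c = (‖c‖ * Real.sqrt 2 * (Real.sqrt (2 - ‖x‖ ^ 2))⁻¹)
      • τ₁ (x, c.arg / (2 * Real.pi)) := by
  have h0 := two_sub_pos hx
  have hS0 : 0 < Real.sqrt (2 - ‖x‖ ^ 2) := Real.sqrt_pos.2 h0
  have hc' : (‖c‖ : ℂ) ≠ 0 := by exact_mod_cast norm_ne_zero_iff.2 hc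
  have h2 : ((Real.sqrt 2 : ℝ) : ℂ) ≠ 0 := by
    exact_mod_cast (Real.sqrt_pos.2 (by norm_num : (0 : ℝ) < 2)).ne'
  have hS : Real.sqrt (1 - ‖x‖ ^ 2 / 2) = Real.sqrt (2 - ‖x‖ ^ 2) / Real.sqrt 2 := by
    rw [← Real.sqrt_div h0.le]
    congr 1
    ring
  have hS' : ((Real.sqrt (2 - ‖x‖ ^ 2) : ℝ) : ℂ) ≠ 0 := by exact_mod_cast hS0.ne'
  rw [τ₁, smul_mk, exp_arg hc, hS, radialMap]
  push_cast
  congr 1 <;> field_simp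

section SolidTorus

/-- The extension of a function on the sphere to a bounded function with bounded support on
`ℝ⁴`, homogeneous of degree zero in the cylinder `‖z₂‖ < 1` up to the factor `(‖z₂‖ / ‖p‖) ^ 4`. -/
def coneExtension (G : R4 → ℝ) (p : R4) : ℝ :=
  if ‖z₂ p‖ < 1 then G (‖p‖⁻¹ • p) * (‖z₂ p‖ / ‖p‖) ^ 4 else 0

theorem coneExtension_smul {G : R4 → ℝ} {u : R4} (hu : ‖u‖ = 1) {r : ℝ} (hr : 0 < r) :
    coneExtension G (r • u) = if r * ‖z₂ u‖ < 1 then G u * ‖z₂ u‖ ^ 4 else 0 := by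
  have h1 : ‖r • u‖ = r := by rw [norm_smul, hu, mul_one, Real.norm_of_nonneg hr.le]
  have h2 : ‖z₂ (r • u)‖ = r * ‖z₂ u‖ := by
    rw [z₂_smul, norm_mul, Complex.norm_real, Real.norm_of_nonneg hr.le]
  rw [coneExtension, h1, h2, smul_smul, inv_mul_cancel₀ hr.ne', one_smul,
    mul_div_cancel_left₀ _ hr.ne']

variable {G : R4 → ℝ}

theorem aestronglyMeasurable_coneExtension (hG : Continuous fun p : S3 => G p) :
    AEStronglyMeasurable (coneExtension G) (volume : Measure R4) := by
  have hproj : ContinuousOn (fun p : R4 => ‖p‖⁻¹ • p) {0}ᶜ :=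
    (continuous_norm.continuousOn.inv₀ fun p hp => norm_ne_zero_iff.2 hp).smul continuousOn_id
  have hGc : ContinuousOn (fun p : R4 => G (‖p‖⁻¹ • p)) {0}ᶜ := by
    rw [continuousOn_iff_continuous_domRestrict] at hproj ⊢
    have hmem : ∀ p : ({0}ᶜ : Set R4), ‖(p : R4)‖⁻¹ • (p : R4) ∈ Metric.sphere (0 : R4) 1 := by
      intro p
      have : ‖(p : R4)‖ ≠ 0 := norm_ne_zero_iff.2 p.2
      simp [norm_smul, this]
    exact hG.comp (Continuous.subtype_mk hproj hmem)
  have hc : ContinuousOn (fun p : R4 => G (‖p‖⁻¹ • p) * (‖z₂ p‖ / ‖p‖) ^ 4) {0}ᶜ :=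
    hGc.mul ((continuous_z₂.norm.continuousOn.div continuous_norm.continuousOn
      fun p hp => norm_ne_zero_iff.2 hp).pow 4)
  have hm := hc.aestronglyMeasurable (μ := (volume : Measure R4))
    (measurableSet_singleton (0 : R4)).compl
  rw [restrict_compl_singleton] at hm
  have hset : MeasurableSet {p : R4 | ‖z₂ p‖ < 1} :=
    (isOpen_lt continuous_z₂.norm continuous_const).measurableSet
  have he : coneExtension G = {p : R4 | ‖z₂ p‖ < 1}.indicator
      fun p => G (‖p‖⁻¹ • p) * (‖z₂ p‖ / ‖p‖) ^ 4 := by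
    funext p
    rw [Set.indicator_apply]
    rfl
  rw [he]
  exact hm.indicator hset

/-- The cylinder `‖z₂‖ < 1` is unbounded, but the support condition forces `‖z₁‖ ≤ ‖z₂‖ < 1`
wherever the function is nonzero, so the ball of radius `2` contains its support. -/
theorem integrable_coneExtension (hG : Continuous fun p : S3 => G p)
    (hsupp : ∀ p : S3, ‖z₂ (p : R4)‖ < ‖z₁ (p : R4)‖ → G p = 0) : Integrable (coneExtension G) (volume : Measure R4) := by
  obtain ⟨C, hC⟩ := (isCompact_univ (X := S3)).exists_bound_of_continuousOn hG.continuousOn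
  have hb : ∀ p : R4, ‖coneExtension G p‖ ≤ max C 0 := by
    intro p
    rw [coneExtension]
    split_ifs
    · rcases eq_or_ne p 0 with rfl | hp
      · simp
      · have h0 : ‖p‖ ≠ 0 := norm_ne_zero_iff.2 hp
        have h1 := hC ⟨‖p‖⁻¹ • p, by simp [norm_smul, h0]⟩ trivial
        have h2 : ‖z₂ p‖ / ‖p‖ ≤ 1 := by
          rw [div_le_one (norm_pos_iff.2 hp), ← pow_le_pow_iff_left₀ (norm_nonneg _) (norm_nonneg _)
            two_ne_zero, norm_sq_eq_z p]
          nlinarith [sq_nonneg ‖z₁ p‖]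
        have h3 : (‖z₂ p‖ / ‖p‖) ^ 4 ≤ 1 := pow_le_one₀ (by positivity) h2
        rw [norm_mul, Real.norm_of_nonneg (by positivity : 0 ≤ (‖z₂ p‖ / ‖p‖) ^ 4)]
        calc _ ≤ ‖G (‖p‖⁻¹ • p)‖ * 1 := by gcongr
          _ ≤ max C 0 := by rw [mul_one]; exact h1.trans (le_max_left _ _)
    · simp
  have hzero : ∀ p, p ∉ Metric.closedBall (0 : R4) 2 → coneExtension G p = 0 := by
    intro p hp
    rw [mem_closedBall_zero_iff, not_le] at hp
    rw [coneExtension]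
    split_ifs with h
    · have h0 : ‖p‖ ≠ 0 := by linarith
      have h1 := norm_sq_eq_z p
      have h2 : ‖z₂ p‖ < ‖z₁ p‖ := by
        by_contra hle
        nlinarith [norm_nonneg (z₁ p), norm_nonneg (z₂ p), norm_nonneg p]
      rw [hsupp ⟨‖p‖⁻¹ • p, by simp [norm_smul, h0]⟩, zero_mul]
      simp only [z₁_smul, z₂_smul, norm_mul]
      have : 0 < ‖((‖p‖⁻¹ : ℝ) : ℂ)‖ := by
        rw [norm_pos_iff]
        exact_mod_cast inv_ne_zero h0
      gcongr
    · rfl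
  have hfin : Integrable ((Metric.closedBall (0 : R4) 2).indicator fun _ => max C 0)
      (volume : Measure R4) :=
    (integrable_indicator_iff Metric.isClosed_closedBall.measurableSet).2
      (integrableOn_const (measure_closedBall_lt_top.ne))
  refine hfin.mono' (aestronglyMeasurable_coneExtension hG) (Filter.Eventually.of_forall fun p => ?_)
  by_cases hp : p ∈ Metric.closedBall (0 : R4) 2
  · rw [Set.indicator_of_mem hp]
    exact hb p
  · rw [Set.indicator_of_notMem hp, hzero p hp, norm_zero]

/-- Polar coordinates in `ℝ⁴`. On the ray through `u` the cutoff is `r < 1/‖z₂ u‖`, and `∫ r³ dr =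
1/(4 ‖z₂ u‖⁴)`; the weight `‖z₂ u‖⁴` makes the result independent of the ray. -/
theorem integral_coneExtension_sphere (hG : Continuous fun p : S3 => G p)
    (hsupp : ∀ p : S3, ‖z₂ (p : R4)‖ < ‖z₁ (p : R4)‖ → G p = 0) :
    ∫ p, coneExtension G p = (1 / 4) * ∫ p : S3, G p ∂(volume : Measure R4).toSphere := by
  have hmp := (volume : Measure R4).measurePreserving_homeomorphUnitSphereProd
  have hemb := (homeomorphUnitSphereProd R4).measurableEmbedding
  set K : S3 × Set.Ioi (0 : ℝ) → ℝ := fun q => coneExtension G ((q.2 : ℝ) • (q.1 : R4)) with hK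
  have hKh : ∀ p : ({0}ᶜ : Set R4), K (homeomorphUnitSphereProd R4 p) = coneExtension G p := by
    intro p
    have h0 : ‖(p : R4)‖ ≠ 0 := norm_ne_zero_iff.2 p.2
    have := (homeomorphUnitSphereProd R4).symm_apply_apply p
    conv_rhs => rw [← this]
    rfl
  have hint : Integrable K ((volume : Measure R4).toSphere.prod
      (Measure.volumeIoiPow (Module.finrank ℝ R4 - 1))) := by
    rw [← hmp.integrable_comp_emb hemb]
    have h1 : Integrable (coneExtension G) ((volume : Measure R4).restrict {0}ᶜ) :=
      (integrable_coneExtension hG hsupp).restrict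
    have h2 := (integrableOn_iff_comap_subtypeVal (measurableSet_singleton (0 : R4)).compl).1 h1
    exact h2.congr (Filter.Eventually.of_forall fun p => (hKh p).symm)
  have h1 : ∫ p, coneExtension G p
      = ∫ p : ({0}ᶜ : Set R4), coneExtension G p ∂((volume : Measure R4).comap (↑)) := by
    rw [integral_subtype_comap (measurableSet_singleton _).compl (coneExtension G),
      restrict_compl_singleton]
  rw [h1]
  simp_rw [← hKh]
  rw [hmp.integral_comp hemb, integral_prod _ hint, ← integral_const_mul]
  congr 1
  funext u
  have hu : ‖(u : R4)‖ = 1 := mem_sphere_zero_iff_norm.1 u.2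
  have hK' : ∀ r : Set.Ioi (0 : ℝ), K (u, r)
      = if (r : ℝ) * ‖z₂ (u : R4)‖ < 1 then G u * ‖z₂ (u : R4)‖ ^ 4 else 0 := fun r =>
    coneExtension_smul hu r.2
  simp_rw [hK']
  rcases eq_or_ne (z₂ (u : R4)) 0 with h0 | h0
  · have hz : G u = 0 := by
      apply hsupp
      have := norm_sq_eq_z (u : R4)
      rw [hu, h0, norm_zero] at this
      rw [h0, norm_zero, norm_pos_iff]
      intro h
      rw [h] at this
      norm_num at this
    simp [hz]
  · have hpos : 0 < ‖z₂ (u : R4)‖ := norm_pos_iff.2 h0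
    have hind : ∀ r : Set.Ioi (0 : ℝ),
        (if (r : ℝ) * ‖z₂ (u : R4)‖ < 1 then G u * ‖z₂ (u : R4)‖ ^ 4 else 0)
        = (Set.Iio (⟨‖z₂ (u : R4)‖⁻¹, inv_pos.2 hpos⟩ : Set.Ioi (0 : ℝ))).indicator
          (fun _ => G u * ‖z₂ (u : R4)‖ ^ 4) r := by
      intro r
      rw [Set.indicator_apply]
      congr 1
      rw [Set.mem_Iio, ← Subtype.coe_lt_coe, eq_iff_iff]
      change _ ↔ (r : ℝ) < ‖z₂ (u : R4)‖⁻¹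
      rw [← one_div, lt_div_iff₀ hpos]
    simp_rw [hind]
    rw [integral_indicator_const _ measurableSet_Iio, measureReal_def,
      Measure.volumeIoiPow_apply_Iio, ENNReal.toReal_ofReal (by positivity)]
    simp only [finrank_euclideanSpace_fin, smul_eq_mul]
    norm_num
    field_simp

/-- Fubini in `ℂ × ℂ`: for fixed `z₂ = c` the variable `z₁` is parametrized by `radialMap c`, whose
Jacobian cancels the weight up to `‖c‖²/2`. Polar coordinates in `c` then give `∫₀¹ r · r²/2 dr =
1/8` and the average over the angle. Together with the integral over rays this yields the factor `π`
without surface parametrizations. -/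
theorem integral_coneExtension_torus (hG : Continuous fun p : S3 => G p)
    (hsupp : ∀ p : S3, ‖z₂ (p : R4)‖ < ‖z₁ (p : R4)‖ → G p = 0) :
    ∫ p, coneExtension G p = (Real.pi / 4) * ∫ t in (0 : ℝ)..1,
      ∫ x in Metric.closedBall (0 : ℂ) 1, G (τ₁ (x, t)) := by
  set Φ : ℝ → ℝ := fun t => ∫ x in Metric.closedBall (0 : ℂ) 1, G (τ₁ (x, t)) with hΦ
  -- The disk of radius `√2` parametrizes all of the sphere with `z₂ ≠ 0`; beyond radius one the
  -- point lies outside the solid torus, where `G` vanishes.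
  have hball : ∀ t, ∫ x in Metric.ball (0 : ℂ) (Real.sqrt 2), G (τ₁ (x, t)) = Φ t := by
    intro t
    refine setIntegral_eq_of_subset_of_forall_sdiff_eq_zero Metric.isOpen_ball.measurableSet
      ?_ ?_
    · exact Metric.closedBall_subset_ball ((Real.lt_sqrt zero_le_one).2 (by norm_num))
    · rintro x ⟨hx, hx1⟩
      have h0 := two_sub_pos hx
      rw [mem_closedBall_zero_iff, not_le] at hx1
      refine hsupp ⟨τ₁ (x, t), mem_sphere_zero_iff_norm.2 (norm_τ₁ (x := x) (by linarith) t)⟩ ?_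
      rw [z₁_τ₁, z₂_τ₁, norm_small, norm_big, Real.sqrt_lt' (by positivity), div_pow,
        Real.sq_sqrt (by norm_num)]
      nlinarith
  have hmp := measurePreserving_coordEquiv.symm
  have hint : Integrable (fun q : ℂ × ℂ => coneExtension G (mk q.1 q.2)) := by
    have := (hmp.integrable_comp_emb coordEquiv.symm.measurableEmbedding).2
      (integrable_coneExtension hG hsupp)
    exact this
  have h1 : ∫ p, coneExtension G p = ∫ q : ℂ × ℂ, coneExtension G (mk q.1 q.2) :=
    (hmp.integral_comp coordEquiv.symm.measurableEmbedding _).symm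
  have hinner : ∀ c : ℂ, c ≠ 0 → ∫ y, coneExtension G (mk y c)
      = if ‖c‖ < 1 then ‖c‖ ^ 2 / 2 * Φ (c.arg / (2 * Real.pi)) else 0 := by
    intro c hc
    have hc0 : 0 < ‖c‖ := norm_pos_iff.2 hc
    rw [integral_radialMap hc]
    have hval : ∀ x ∈ Metric.ball (0 : ℂ) (Real.sqrt 2),
        ‖c‖ ^ 2 * (2 / (2 - ‖x‖ ^ 2) ^ 2) * coneExtension G (mk (radialMap c x) c)
        = if ‖c‖ < 1 then ‖c‖ ^ 2 / 2 * G (τ₁ (x, c.arg / (2 * Real.pi))) else 0 := by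
      intro x hx
      have h0 := two_sub_pos hx
      set S := Real.sqrt (2 - ‖x‖ ^ 2) with hS
      have hS0 : 0 < S := Real.sqrt_pos.2 h0
      have hS2 : S ^ 2 = 2 - ‖x‖ ^ 2 := Real.sq_sqrt h0.le
      have hz : ‖z₂ (τ₁ (x, c.arg / (2 * Real.pi)))‖ = S / Real.sqrt 2 := by
        rw [z₂_τ₁, norm_big, hS, ← Real.sqrt_div h0.le]
        congr 1
        ring
      have h2 : 0 < Real.sqrt 2 := Real.sqrt_pos.2 (by norm_num)
      have h22 : Real.sqrt 2 ^ 2 = 2 := Real.sq_sqrt (by norm_num)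
      rw [mk_radialMap hc hx, coneExtension_smul (norm_τ₁ (by linarith) _) (by positivity), hz,
        ← hS]
      have h3 : ‖c‖ * Real.sqrt 2 * S⁻¹ * (S / Real.sqrt 2) = ‖c‖ := by field_simp
      rw [h3, ← hS2]
      split_ifs
      · have h24 : Real.sqrt 2 ^ 4 = 4 := by
          rw [show (4 : ℕ) = 2 * 2 from rfl, pow_mul, h22]
          norm_num
        rw [div_pow, h24]
        field_simp
        ring
      · simp
    rw [setIntegral_congr_fun Metric.isOpen_ball.measurableSet hval]
    split_ifs
    · rw [integral_const_mul, hball]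
    · simp
  have hper : Function.Periodic Φ 1 := by
    intro t
    simp only [hΦ]
    congr 1
    funext x
    congr 1
    have := exp_int t 1
    push_cast at this
    simp only [τ₁]
    push_cast
    rw [this]
  have hae : (fun c : ℂ => ∫ y, coneExtension G (mk y c)) =ᵐ[volume]
      fun c => if ‖c‖ < 1 then ‖c‖ ^ 2 / 2 * Φ (c.arg / (2 * Real.pi)) else 0 := by
    have : ∀ᵐ c : ℂ, c ≠ 0 := by
      simp [ae_iff, measure_singleton]
    filter_upwards [this] with c hc using hinner c hc
  rw [h1, Measure.volume_eq_prod, integral_prod_symm _ hint, integral_congr_ae hae,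
    ← Complex.integral_comp_polarCoord_symm]
  have hpolar : ∀ q ∈ polarCoord.target, q.1 • (if ‖Complex.polarCoord.symm q‖ < 1 then
      ‖Complex.polarCoord.symm q‖ ^ 2 / 2 * Φ ((Complex.polarCoord.symm q).arg / (2 * Real.pi))
      else 0) = (Set.Iio (1 : ℝ)).indicator (fun r => r ^ 3 / 2) q.1 * Φ (q.2 / (2 * Real.pi)) := by
    rintro ⟨r, θ⟩ ⟨hr, hθ⟩
    simp only [Set.mem_Ioi] at hr
    rw [Complex.norm_polarCoord_symm, abs_of_pos hr, Complex.polarCoord_symm_apply]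
    simp only [Complex.ofReal_cos, Complex.ofReal_sin]
    rw [Complex.arg_mul_cos_add_sin_mul_I hr ⟨hθ.1, hθ.2.le⟩, Set.indicator_apply]
    simp only [Set.mem_Iio, smul_eq_mul]
    split_ifs
    · ring
    · simp
  rw [setIntegral_congr_fun polarCoord.open_target.measurableSet hpolar, polarCoord_target,
    Measure.volume_eq_prod,
    setIntegral_prod_mul (μ := (volume : Measure ℝ)) (ν := (volume : Measure ℝ))
      ((Set.Iio (1 : ℝ)).indicator fun r => r ^ 3 / 2) fun θ => Φ (θ / (2 * Real.pi))]
  have hr : ∫ r in Set.Ioi (0 : ℝ), (Set.Iio (1 : ℝ)).indicator (fun r => r ^ 3 / 2) r = 1 / 8 := by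
    rw [setIntegral_indicator measurableSet_Iio, Set.Ioi_inter_Iio, ← integral_Ioc_eq_integral_Ioo,
      ← intervalIntegral.integral_of_le zero_le_one, intervalIntegral.integral_div, integral_pow]
    norm_num
  -- The range of `arg` gives the time interval from `-1/2` to `1/2`, which periodicity moves to
  -- `[0, 1]`.
  have hθ : ∫ θ in Set.Ioo (-Real.pi) Real.pi, Φ (θ / (2 * Real.pi))
      = 2 * Real.pi * ∫ t in (0 : ℝ)..1, Φ t := by
    have hpi := Real.pi_pos
    rw [← integral_Ioc_eq_integral_Ioo, ← intervalIntegral.integral_of_le (by linarith),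
      intervalIntegral.integral_comp_div _ (by positivity), smul_eq_mul]
    congr 1
    have h := hper.intervalIntegral_add_eq (-(1 / 2)) 0
    have e1 : -Real.pi / (2 * Real.pi) = -(1 / 2) := by field_simp
    have e2 : Real.pi / (2 * Real.pi) = -(1 / 2) + 1 := by field_simp; norm_num
    rw [e1, e2, h, zero_add]
  rw [hr, hθ]
  ring

/-- Integration over the solid torus `{‖z₁‖ ≤ ‖z₂‖}` in the coordinates given by `τ₁`. -/
theorem integral_solidTorus (hG : Continuous fun p : S3 => G p)
    (hsupp : ∀ p : S3, ‖z₂ (p : R4)‖ < ‖z₁ (p : R4)‖ → G p = 0) :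
    ∫ p : S3, G p ∂(volume : Measure R4).toSphere = Real.pi * ∫ t in (0 : ℝ)..1,
      ∫ x in Metric.closedBall (0 : ℂ) 1, G (τ₁ (x, t)) := by
  have h := integral_coneExtension_sphere hG hsupp
  rw [integral_coneExtension_torus hG hsupp] at h
  linarith

end SolidTorus

theorem toSphere_real_univ : (volume : Measure R4).toSphere.real Set.univ = 2 * Real.pi ^ 2 := by
  rw [Measure.toSphere_real_apply_univ, measureReal_def,
    InnerProductSpace.volume_ball_of_dim_even (k := 2) (by simp), finrank_euclideanSpace_fin]
  simp [ENNReal.toReal_ofReal (by positivity : 0 ≤ Real.pi ^ 2 / 2)]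
  ring

/-! ### The differential of `τ₁` -/

/-- The covector `ι_u ω`. -/
def areaL (u : ℂ) : ℂ →L[ℝ] ℝ := u.re • Complex.imCLM - u.im • Complex.reCLM

@[simp]
theorem areaL_apply (u v : ℂ) : areaL u v = areaForm u v := by
  simp [areaL, areaForm]

/-- The area form as a linear map to covectors. -/
def areaLL : ℂ →L[ℝ] ℂ →L[ℝ] ℝ :=
  Complex.reCLM.smulRight Complex.imCLM - Complex.imCLM.smulRight Complex.reCLM

theorem areaLL_apply (u : ℂ) : areaLL u = areaL u := rfl

theorem hasFDerivAt_exp_time (q : ℂ × ℝ) :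
    HasFDerivAt (fun q : ℂ × ℝ => Complex.exp (2 * Real.pi * q.2 * Complex.I))
      ((ContinuousLinearMap.snd ℝ ℂ ℝ).smulRight
        (Complex.exp (2 * Real.pi * q.2 * Complex.I) * (2 * Real.pi * Complex.I))) q := by
  have h : HasDerivAt (fun s : ℝ => Complex.exp (2 * Real.pi * s * Complex.I))
      (Complex.exp (2 * Real.pi * q.2 * Complex.I) * (2 * Real.pi * Complex.I)) q.2 := by
    have h1 : HasDerivAt (fun s : ℝ => (2 * Real.pi * s * Complex.I : ℂ))
        (2 * Real.pi * Complex.I) q.2 := by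
      simpa using ((Complex.ofRealCLM.hasDerivAt (x := q.2)).const_mul
        (2 * Real.pi : ℂ)).mul_const Complex.I
    exact h1.cexp
  have h2 := HasFDerivAt.comp (g := fun s : ℝ => Complex.exp (2 * Real.pi * s * Complex.I)) q
    h.hasFDerivAt (hasFDerivAt_snd (𝕜 := ℝ) (p := q))
  refine h2.congr_fderiv ?_
  ext <;> simp

theorem norm_sq_complex (z : ℂ) : ‖z‖ ^ 2 = z.re ^ 2 + z.im ^ 2 := by
  rw [← Complex.normSq_eq_norm_sq, Complex.normSq_apply]
  ring

theorem hasFDerivAt_height {x : ℂ} (hx : ‖x‖ ^ 2 < 2) (t : ℝ) :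
    HasFDerivAt (fun q : ℂ × ℝ => Real.sqrt (1 - ‖q.1‖ ^ 2 / 2))
      ((-(2 * Real.sqrt (1 - ‖x‖ ^ 2 / 2))⁻¹ : ℝ) • (innerSL ℝ x).comp (.fst ℝ ℂ ℝ)) (x, t) := by
  have h0 : 0 < 1 - ‖x‖ ^ 2 / 2 := by linarith
  have h1 : HasFDerivAt (fun y : ℂ => ‖y‖ ^ 2) (2 • innerSL ℝ x) x :=
    (hasStrictFDerivAt_norm_sq x).hasFDerivAt
  have h2 := ((h1.mul_const (1 / 2 : ℝ)).const_sub 1).sqrt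
    (by rw [mul_one_div]; exact h0.ne')
  have h3 : HasFDerivAt (fun q : ℂ × ℝ => Real.sqrt (1 - ‖q.1‖ ^ 2 * (1 / 2))) _ (x, t) :=
    HasFDerivAt.comp (g := fun y : ℂ => Real.sqrt (1 - ‖y‖ ^ 2 * (1 / 2))) (x, t) h2
    (hasFDerivAt_fst (𝕜 := ℝ) (p := (x, t)))
  simp only [mul_one_div] at h3
  refine h3.congr_fderiv ?_
  ext <;> simp
  field_simp
  simp

theorem contDiffAt_τ₁ {x : ℂ} (hx : ‖x‖ ^ 2 < 2) (t : ℝ) : ContDiffAt ℝ ∞ τ₁ (x, t) := by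
  have hof : ContDiff ℝ ∞ (fun r : ℝ => (r : ℂ)) := Complex.ofRealCLM.contDiff
  have hE : ContDiff ℝ ∞ (fun q : ℂ × ℝ => Complex.exp (2 * Real.pi * q.2 * Complex.I)) :=
    ((contDiff_const.mul (hof.comp contDiff_snd)).mul contDiff_const).cexp
  have hS : ContDiffAt ℝ ∞ (fun q : ℂ × ℝ => Real.sqrt (1 - ‖q.1‖ ^ 2 / 2)) (x, t) := by
    refine ContDiffAt.sqrt ?_ (by simp only; linarith)
    exact (contDiff_const.sub ((contDiff_fst.norm_sq ℝ).div_const 2)).contDiffAt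
  have h1 : ContDiffAt ℝ ∞ (fun q : ℂ × ℝ =>
      Complex.exp (2 * Real.pi * q.2 * Complex.I) * (q.1 / Real.sqrt 2)) (x, t) :=
    (hE.mul (contDiff_fst.div_const _)).contDiffAt
  have h2 : ContDiffAt ℝ ∞ (fun q : ℂ × ℝ => Complex.exp (2 * Real.pi * q.2 * Complex.I)
      * ((Real.sqrt (1 - ‖q.1‖ ^ 2 / 2) : ℝ) : ℂ)) (x, t) :=
    hE.contDiffAt.mul (hof.contDiffAt.comp _ hS)
  rw [contDiffAt_euclidean]
  intro i
  have hre : ContDiff ℝ ∞ Complex.re := Complex.reCLM.contDiff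
  have him : ContDiff ℝ ∞ Complex.im := Complex.imCLM.contDiff
  fin_cases i
  · exact hre.contDiffAt.comp _ h1
  · exact him.contDiffAt.comp _ h1
  · exact hre.contDiffAt.comp _ h2
  · exact him.contDiffAt.comp _ h2

theorem z₁_fderiv_τ₁ {x : ℂ} (hx : ‖x‖ ^ 2 < 2) (t : ℝ) (w : ℂ × ℝ) :
    z₁ (fderiv ℝ τ₁ (x, t) w) = Complex.exp (2 * Real.pi * t * Complex.I)
      * ((w.1 + 2 * Real.pi * w.2 * Complex.I * x) / Real.sqrt 2) := by
  have hd := (contDiffAt_τ₁ hx t).differentiableAt (by simp)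
  have h1 := z₁L.hasFDerivAt.comp (x, t) hd.hasFDerivAt
  have h2 := (hasFDerivAt_exp_time (x, t)).mul
    ((hasFDerivAt_fst (𝕜 := ℝ) (p := (x, t))).mul_const (Real.sqrt 2 : ℂ)⁻¹)
  have he : z₁L ∘ τ₁ = (fun q : ℂ × ℝ => Complex.exp (2 * Real.pi * q.2 * Complex.I))
      * fun q => q.1 * (Real.sqrt 2 : ℂ)⁻¹ := by
    funext q
    rw [Function.comp_apply, z₁L_apply]
    rfl
  rw [he] at h1
  have h3 := congrArg (fun L => L w) (h1.unique h2)
  simp only [ContinuousLinearMap.comp_apply, z₁L_apply] at h3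
  rw [h3]
  simp
  ring

theorem z₂_fderiv_τ₁ {x : ℂ} (hx : ‖x‖ ^ 2 < 2) (t : ℝ) (w : ℂ × ℝ) :
    z₂ (fderiv ℝ τ₁ (x, t) w) = Complex.exp (2 * Real.pi * t * Complex.I)
      * ⟨-(x.re * w.1.re + x.im * w.1.im) / (2 * Real.sqrt (1 - ‖x‖ ^ 2 / 2)),
        2 * Real.pi * w.2 * Real.sqrt (1 - ‖x‖ ^ 2 / 2)⟩ := by
  have hm : (⟨-(x.re * w.1.re + x.im * w.1.im) / (2 * Real.sqrt (1 - ‖x‖ ^ 2 / 2)),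
        2 * Real.pi * w.2 * Real.sqrt (1 - ‖x‖ ^ 2 / 2)⟩ : ℂ)
      = ((-(inner ℝ x w.1) / (2 * Real.sqrt (1 - ‖x‖ ^ 2 / 2)) : ℝ) : ℂ)
        + ((2 * Real.pi * w.2 * Real.sqrt (1 - ‖x‖ ^ 2 / 2) : ℝ) : ℂ) * Complex.I := by
    rw [Complex.mk_eq_add_mul_I, Complex.inner]
    simp only [Complex.mul_re, Complex.conj_re, Complex.conj_im]
    congr 4
    ring
  rw [hm]
  have hd := (contDiffAt_τ₁ hx t).differentiableAt (by simp)
  have h1 := z₂L.hasFDerivAt.comp (x, t) hd.hasFDerivAt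
  have h2 := (hasFDerivAt_exp_time (x, t)).mul
    (Complex.ofRealCLM.hasFDerivAt.comp (x, t) (hasFDerivAt_height hx t))
  have he : z₂L ∘ τ₁ = (fun q : ℂ × ℝ => Complex.exp (2 * Real.pi * q.2 * Complex.I))
      * (Complex.ofRealCLM ∘ fun q : ℂ × ℝ => Real.sqrt (1 - ‖q.1‖ ^ 2 / 2)) := by
    funext q
    rw [Function.comp_apply, z₂L_apply]
    rfl
  rw [he] at h1
  have h3 := congrArg (fun L => L w) (h1.unique h2)
  simp only [ContinuousLinearMap.comp_apply, z₂L_apply] at h3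
  rw [h3]
  simp
  ring

theorem inner_eq_z (p q : R4) : inner ℝ p q = inner ℝ (z₁ p) (z₁ q) + inner ℝ (z₂ p) (z₂ q) := by
  rw [inner_R4]
  simp only [Complex.inner, Complex.mul_re, Complex.conj_re, Complex.conj_im, z₁, z₂]
  ring

theorem inner_rot {E : ℂ} (hE : ‖E‖ = 1) (a b : ℂ) : inner ℝ (E * a) (E * b) = inner ℝ a b := by
  have h := norm_sq_complex E
  rw [hE, one_pow] at h
  simp only [Complex.inner, Complex.mul_re, Complex.conj_re, Complex.conj_im, Complex.mul_im]
  linear_combination (-(a.re * b.re) - a.im * b.im) * h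

theorem areaForm_rot {E : ℂ} (hE : ‖E‖ = 1) (a b : ℂ) :
    areaForm (E * a) (E * b) = areaForm a b := by
  have h := norm_sq_complex E
  rw [hE, one_pow] at h
  simp only [areaForm, Complex.mul_re, Complex.mul_im]
  linear_combination (-(a.re * b.im) + a.im * b.re) * h

/-- Multiplication of both coordinates by `E` has real determinant `‖E‖⁴ = 1`. This removes the
factor `exp (2πit)` from the computation with `τ₁`. -/
theorem dV_rot {E : ℂ} (hE : ‖E‖ = 1) (a b c d a' b' c' d' : ℂ) :
    dV (mk (E * a) (E * a')) (mk (E * b) (E * b')) (mk (E * c) (E * c')) (mk (E * d) (E * d'))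
      = dV (mk a a') (mk b b') (mk c c') (mk d d') := by
  have h := norm_sq_complex E
  rw [hE, one_pow] at h
  have key : dV (mk (E * a) (E * a')) (mk (E * b) (E * b')) (mk (E * c) (E * c'))
      (mk (E * d) (E * d'))
      = (E.re ^ 2 + E.im ^ 2) ^ 2 * dV (mk a a') (mk b b') (mk c c') (mk d d') := by
    simp only [dV_eq, mk]
    simp
    ring
  rw [key, ← h, one_pow, one_mul]

theorem fderiv_τ₁_tangent {x : ℂ} (hx : ‖x‖ ^ 2 < 2) (t : ℝ) (w : ℂ × ℝ) :
    inner ℝ (τ₁ (x, t)) (fderiv ℝ τ₁ (x, t) w) = 0 := by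
  have h0 : 0 < 1 - ‖x‖ ^ 2 / 2 := by linarith
  have hS := Real.sqrt_pos.2 h0
  have h2 : Real.sqrt 2 ^ 2 = 2 := Real.sq_sqrt (by norm_num)
  have h20 : Real.sqrt 2 ≠ 0 := (Real.sqrt_pos.2 (by norm_num)).ne'
  rw [inner_eq_z, z₁_fderiv_τ₁ hx, z₂_fderiv_τ₁ hx, z₁_τ₁, z₂_τ₁, inner_rot (norm_rot t),
    inner_rot (norm_rot t)]
  generalize Real.sqrt (1 - ‖x‖ ^ 2 / 2) = S at hS ⊢
  simp [Complex.inner]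
  field_simp
  rw [h2]
  ring

/-- Every tangent vector of the sphere at a point of the solid torus is in the image of the
differential of `τ₁`. -/
theorem exists_fderiv_τ₁_eq {x : ℂ} (hx : ‖x‖ ^ 2 < 2) (t : ℝ) {v : R4}
    (hv : inner ℝ (τ₁ (x, t)) v = 0) : ∃ w : ℂ × ℝ, fderiv ℝ τ₁ (x, t) w = v := by
  have h0 : 0 < 1 - ‖x‖ ^ 2 / 2 := by linarith
  have hS := Real.sqrt_pos.2 h0
  have h2 : Real.sqrt 2 ^ 2 = 2 := Real.sq_sqrt (by norm_num)
  have h20 : Real.sqrt 2 ≠ 0 := (Real.sqrt_pos.2 (by norm_num)).ne'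
  have hE := norm_rot t
  set E := Complex.exp (2 * Real.pi * t * Complex.I) with hEdef
  set S := Real.sqrt (1 - ‖x‖ ^ 2 / 2) with hSdef
  have hE0 : E ≠ 0 := Complex.exp_ne_zero _
  obtain ⟨a, ha⟩ : ∃ a, z₁ v = E * a := ⟨z₁ v / E, (mul_div_cancel₀ _ hE0).symm⟩
  obtain ⟨b, hb⟩ : ∃ b, z₂ v = E * b := ⟨z₂ v / E, (mul_div_cancel₀ _ hE0).symm⟩
  rw [inner_eq_z, z₁_τ₁, z₂_τ₁, ha, hb, inner_rot hE, inner_rot hE] at hv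
  -- After rotation by `E`, the imaginary part of the second coordinate determines the time
  -- component, and the first coordinate then determines the disk component. The real part of the
  -- second coordinate is forced by tangency.
  set c : ℝ := b.im / (2 * Real.pi * S) with hc
  refine ⟨(Real.sqrt 2 * a - 2 * Real.pi * c * Complex.I * x, c), ?_⟩
  rw [← mk_z (fderiv ℝ τ₁ (x, t) _), ← mk_z v, z₁_fderiv_τ₁ hx, z₂_fderiv_τ₁ hx, ha, hb]
  have h20' : (Real.sqrt 2 : ℂ) ≠ 0 := by exact_mod_cast h20
  congr 2
  · field_simp
    ring
  · have hpi := Real.pi_ne_zero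
    rw [← hSdef] at hv ⊢
    apply Complex.ext
    · simp [Complex.inner] at hv ⊢
      field_simp at hv ⊢
      linear_combination -Real.sqrt 2 * hv + b.re * S * h2
    · simp only [hc]
      field_simp

/-- The pullback of the volume form is the constant multiple `π ω ∧ dt`, which is why the suspension
pushes forward to a divergence-free field. -/
theorem dV_fderiv_τ₁ {x : ℂ} (hx : ‖x‖ ^ 2 < 2) (t : ℝ) (u v w : ℂ × ℝ) :
    dV (τ₁ (x, t)) (fderiv ℝ τ₁ (x, t) u) (fderiv ℝ τ₁ (x, t) v) (fderiv ℝ τ₁ (x, t) w)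
      = Real.pi * (areaForm u.1 v.1 * w.2 - areaForm u.1 w.1 * v.2 + areaForm v.1 w.1 * u.2) := by
  have h0 : 0 < 1 - ‖x‖ ^ 2 / 2 := by linarith
  have hS := Real.sqrt_pos.2 h0
  have hS2 := Real.sq_sqrt h0.le
  have h2 : Real.sqrt 2 ^ 2 = 2 := Real.sq_sqrt (by norm_num)
  have h20 : Real.sqrt 2 ≠ 0 := (Real.sqrt_pos.2 (by norm_num)).ne'
  rw [← mk_z (τ₁ (x, t)), ← mk_z (fderiv ℝ τ₁ (x, t) u), ← mk_z (fderiv ℝ τ₁ (x, t) v),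
    ← mk_z (fderiv ℝ τ₁ (x, t) w)]
  simp only [z₁_fderiv_τ₁ hx, z₂_fderiv_τ₁ hx, z₁_τ₁, z₂_τ₁]
  rw [dV_rot (norm_rot t)]
  generalize Real.sqrt (1 - ‖x‖ ^ 2 / 2) = S at hS hS2 ⊢
  rw [norm_sq_complex] at hS2
  simp only [dV_eq, mk, areaForm]
  simp
  field_simp
  rw [hS2, h2]
  ring

/-! ### The exchange of the two solid tori -/

/-- The exchange of the two complex coordinates. -/
def swapIso : R4 ≃ₗᵢ[ℝ] R4 where
  toFun p := mk (z₂ p) (z₁ p)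
  invFun p := mk (z₂ p) (z₁ p)
  left_inv p := by simp
  right_inv p := by simp
  map_add' p q := by
    ext i
    fin_cases i <;> simp [mk, z₁, z₂]
  map_smul' r p := by
    ext i
    fin_cases i <;> simp [mk, z₁, z₂]
  norm_map' p := by
    change ‖mk (z₂ p) (z₁ p)‖ = ‖p‖
    rw [← pow_left_inj₀ (norm_nonneg _) (norm_nonneg _) two_ne_zero, norm_sq_eq_z, norm_sq_eq_z p,
      z₁_mk, z₂_mk, add_comm]

@[simp]
theorem z₁_swapIso (p : R4) : z₁ (swapIso p) = z₂ p := rfl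

@[simp]
theorem z₂_swapIso (p : R4) : z₂ (swapIso p) = z₁ p := rfl

@[simp]
theorem swapIso_swapIso (p : R4) : swapIso (swapIso p) = p := swapIso.left_inv p

/-- The exchange is a product of two transpositions of real coordinates, so it preserves
orientation. All statements about the second solid torus can thus be deduced from the first. -/
theorem dV_swapIso (p u v w : R4) :
    dV (swapIso p) (swapIso u) (swapIso v) (swapIso w) = dV p u v w := by
  have h : ∀ q : R4, swapIso q 0 = q 2 ∧ swapIso q 1 = q 3 ∧ swapIso q 2 = q 0 ∧ swapIso q 3 = q 1 :=
    fun q => ⟨rfl, rfl, rfl, rfl⟩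
  simp only [dV_eq, h]
  ring

theorem fderiv_τ₂ (q w : ℂ × ℝ) : fderiv ℝ τ₂ q w = swapIso (fderiv ℝ τ₁ q w) := by
  have h : τ₂ = swapIso ∘ τ₁ := rfl
  have h2 := swapIso.toContinuousLinearEquiv.comp_fderiv (f := τ₁) (x := q)
  rw [h]
  exact congrArg (fun L => L w) h2

/-! ### Functions on the solid tori -/

/-- A smooth function on the solid torus `D² × ℝ/ℤ` with compact support in its interior. -/
structure IsTorusFunction (F : ℝ → ℂ → ℝ) (r : ℝ) : Prop where
  smooth : ContDiff ℝ ∞ fun q : ℝ × ℂ => F q.1 q.2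
  periodic : ∀ t x, F (t + 1) x = F t x
  pos : 0 < r
  lt_one : r < 1
  support : ∀ t x, r ≤ ‖x‖ → F t x = 0

/-- The function on the sphere that is `F` in the solid torus `{‖z₁‖ ≤ ‖z₂‖}`, and zero outside. -/
def torusExt (F : ℝ → ℂ → ℝ) (p : R4) : ℝ :=
  if ‖z₁ p‖ ≤ ‖z₂ p‖ then F (τ₁Inv p).2 (τ₁Inv p).1 else 0

/-- The coefficient of the one-form `π F dt` with respect to `x₂ dy₂ - y₂ dx₂`. -/
def torusCoeff (F : ℝ → ℂ → ℝ) (p : R4) : ℝ := torusExt F p / (2 * ‖z₂ p‖ ^ 2)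

theorem norm_τ₁Inv {p : R4} (h : z₂ p ≠ 0) : ‖(τ₁Inv p).1‖ = Real.sqrt 2 * ‖z₁ p‖ := by
  have h' : ‖z₂ p‖ ≠ 0 := norm_ne_zero_iff.2 h
  simp only [τ₁Inv, norm_div, norm_mul, RCLike.norm_conj, Complex.norm_real, norm_norm,
    Real.norm_of_nonneg (Real.sqrt_nonneg 2)]
  field_simp

/-- The first solid torus is the image of `τ₁`. -/
theorem exists_eq_τ₁ (p : S3) (h : ‖z₁ (p : R4)‖ ≤ ‖z₂ (p : R4)‖) :
    ∃ x t, ‖x‖ ≤ 1 ∧ (p : R4) = τ₁ (x, t) := by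
  have hp : ‖z₁ (p : R4)‖ ^ 2 + ‖z₂ (p : R4)‖ ^ 2 = 1 := by
    rw [← norm_sq_eq_z, mem_sphere_zero_iff_norm.1 p.2, one_pow]
  generalize (p : R4) = q at h hp
  have hz : z₂ q ≠ 0 := by
    intro h0
    rw [h0, norm_zero] at h
    rw [h0, norm_zero, le_antisymm h (norm_nonneg _)] at hp
    norm_num at hp
  have hn := norm_τ₁Inv hz
  have h2 : Real.sqrt 2 ^ 2 = 2 := Real.sq_sqrt (by norm_num)
  have hn2 : ‖(τ₁Inv q).1‖ ^ 2 = 2 * ‖z₁ q‖ ^ 2 := by rw [hn, mul_pow, h2]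
  refine ⟨(τ₁Inv q).1, (τ₁Inv q).2, ?_, ?_⟩
  · rw [← sq_le_one_iff₀ (norm_nonneg _), hn2]
    nlinarith [norm_nonneg (z₁ q)]
  · have hE : Complex.exp (2 * Real.pi * ((τ₁Inv q).2 : ℂ) * Complex.I) = z₂ q / ‖z₂ q‖ :=
      exp_arg hz
    have hS : Real.sqrt (1 - ‖(τ₁Inv q).1‖ ^ 2 / 2) = ‖z₂ q‖ := by
      rw [hn2, Real.sqrt_eq_iff_eq_sq (by nlinarith [sq_nonneg ‖z₂ q‖]) (norm_nonneg _)]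
      linarith
    have hz' : (‖z₂ q‖ : ℂ) ≠ 0 := by exact_mod_cast norm_ne_zero_iff.2 hz
    have h2' : ((Real.sqrt 2 : ℝ) : ℂ) ≠ 0 := by
      exact_mod_cast (Real.sqrt_pos.2 (by norm_num : (0 : ℝ) < 2)).ne'
    have hzz : z₂ q * (starRingEnd ℂ) (z₂ q) = (‖z₂ q‖ : ℂ) ^ 2 := Complex.mul_conj' _
    rw [τ₁, hE, hS]
    conv_lhs => rw [← mk_z q]
    congr 1
    · simp only [τ₁Inv]
      field_simp
      linear_combination -z₁ q * hzz
    · field_simp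

/-! ### Smooth extension by zero and its integral -/

namespace IsTorusFunction

variable {F : ℝ → ℂ → ℝ} {r : ℝ}

theorem periodic_int (hF : IsTorusFunction F r) (t : ℝ) (n : ℤ) : F (t + n) = F t := by
  have hp : Function.Periodic F 1 := fun s => funext (hF.periodic s)
  simpa using hp.int_mul n t

theorem torusExt_eq_zero (hF : IsTorusFunction F r) {p : R4} (h : r ≤ Real.sqrt 2 * ‖z₁ p‖) :
    torusExt F p = 0 := by
  rw [torusExt]
  split_ifs with hle
  · apply hF.support
    have hz : z₂ p ≠ 0 := by
      intro h0
      rw [h0, norm_zero] at hle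
      rw [le_antisymm hle (norm_nonneg _), mul_zero] at h
      exact absurd hF.pos (not_lt.2 h)
    rwa [norm_τ₁Inv hz]
  · rfl

theorem torusExt_eventuallyEq_zero (hF : IsTorusFunction F r) {p : R4}
    (h : r < Real.sqrt 2 * ‖z₁ p‖) : torusExt F =ᶠ[nhds p] fun _ => 0 := by
  have hc : Continuous fun q : R4 => Real.sqrt 2 * ‖z₁ q‖ := continuous_const.mul continuous_z₁.norm
  filter_upwards [hc.continuousAt.eventually (lt_mem_nhds h)] with q hq
  exact hF.torusExt_eq_zero (le_of_lt hq)

theorem torusExt_τ₁ (hF : IsTorusFunction F r) (x : ℂ) (t : ℝ) :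
    torusExt F (τ₁ (x, t)) = F t x := by
  rcases le_or_gt ‖x‖ 1 with h1 | h1
  · have hle : ‖z₁ (τ₁ (x, t))‖ ≤ ‖z₂ (τ₁ (x, t))‖ := by
      rw [z₁_τ₁, z₂_τ₁, norm_small, norm_big]
      exact small_le_big h1
    obtain ⟨n, hn⟩ := inv_aux h1 t _ _ (z₁_τ₁ x t) (z₂_τ₁ x t)
    have hinv : τ₁Inv (τ₁ (x, t)) = (x, t + n) := hn
    rw [torusExt, if_pos hle, hinv, hF.periodic_int]
  · rw [hF.torusExt_eq_zero, hF.support t x (hF.lt_one.le.trans h1.le)]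
    rw [z₁_τ₁, norm_small, mul_div_cancel₀ _ (Real.sqrt_pos.2 (by norm_num)).ne']
    exact hF.lt_one.le.trans h1.le

/-- On the complementary solid torus `‖z₁‖² ≥ 1/2`. The strict inequality leaves room for the
function to vanish in a neighbourhood of the common boundary. -/
theorem lt_sqrt_two_mul_norm_z₁ (hF : IsTorusFunction F r) (p : S3)
    (h : ‖z₂ (p : R4)‖ ≤ ‖z₁ (p : R4)‖) : r < Real.sqrt 2 * ‖z₁ (p : R4)‖ := by
  have hp : ‖z₁ (p : R4)‖ ^ 2 + ‖z₂ (p : R4)‖ ^ 2 = 1 := by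
    rw [← norm_sq_eq_z, mem_sphere_zero_iff_norm.1 p.2, one_pow]
  have h1 : (1 : ℝ) ≤ Real.sqrt 2 * ‖z₁ (p : R4)‖ := by
    rw [← one_le_sq_iff₀ (by positivity), mul_pow, Real.sq_sqrt (by norm_num)]
    nlinarith [norm_nonneg (z₂ (p : R4))]
  exact hF.lt_one.trans_le h1

theorem contDiffAt_torusExt (hF : IsTorusFunction F r) (p : S3) :
    ContDiffAt ℝ ∞ (torusExt F) p := by
  rcases le_or_gt ‖z₂ (p : R4)‖ ‖z₁ (p : R4)‖ with h | h
  · exact contDiffAt_const.congr_of_eventuallyEq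
      (hF.torusExt_eventuallyEq_zero (hF.lt_sqrt_two_mul_norm_z₁ p h))
  have hz : z₂ (p : R4) ≠ 0 := norm_pos_iff.1 ((norm_nonneg _).trans_lt h)
  have hz1 : ContDiff ℝ ∞ z₁ := by
    have := z₁L.contDiff (n := ∞)
    rwa [show (z₁L : R4 → ℂ) = z₁ from funext z₁L_apply] at this
  have hz2 : ContDiff ℝ ∞ z₂ := by
    have := z₂L.contDiff (n := ∞)
    rwa [show (z₂L : R4 → ℂ) = z₂ from funext z₂L_apply] at this
  have hof : ContDiff ℝ ∞ (fun r : ℝ => (r : ℂ)) := Complex.ofRealCLM.contDiff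
  set ζ := z₂ (p : R4) with hζ
  have hlog : ContDiffAt ℝ ∞ (fun q : R4 => Complex.log (z₂ q / ζ)) p := by
    have h1 : ContDiffAt ℝ ∞ Complex.log (z₂ (p : R4) / ζ) := by
      rw [← hζ, div_self hz]
      exact (Complex.contDiffAt_log Complex.one_mem_slitPlane).restrict_scalars ℝ
    exact ContDiffAt.comp (g := Complex.log) (p : R4) h1 (hz2.div_const ζ).contDiffAt
  -- A branch of the angular time that is smooth near `p`, wherever the cut of `arg` lies. It
  -- differs from `(τ₁Inv q).2` by an integer, which periodicity of `F` absorbs.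
  set s : R4 → ℝ := fun q => ((Complex.log (z₂ q / ζ)).im + ζ.arg) / (2 * Real.pi) with hs
  have hsm : ContDiffAt ℝ ∞ s p :=
    ((Complex.imCLM.contDiff.contDiffAt.comp _ hlog).add contDiffAt_const).div_const _
  have hxm : ContDiffAt ℝ ∞ (fun q => (τ₁Inv q).1) p := by
    simp only [τ₁Inv]
    refine ((contDiffAt_const.mul hz1.contDiffAt).mul
      (Complex.conjCLE.contDiff.contDiffAt.comp _ hz2.contDiffAt)).mul ?_
    refine ContDiffAt.inv (hof.contDiffAt.comp _ (hz2.contDiffAt.norm ℝ hz)) ?_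
    exact_mod_cast norm_ne_zero_iff.2 hz
  have hev : torusExt F =ᶠ[nhds (p : R4)] fun q => F (s q) (τ₁Inv q).1 := by
    have e1 : ∀ᶠ q in nhds (p : R4), ‖z₁ q‖ < ‖z₂ q‖ :=
      (isOpen_lt continuous_z₁.norm continuous_z₂.norm).mem_nhds h
    filter_upwards [e1] with q hq
    have hzq : z₂ q ≠ 0 := norm_pos_iff.1 ((norm_nonneg _).trans_lt hq)
    rw [torusExt, if_pos hq.le]
    have hexp : Complex.exp ((z₂ q).arg * Complex.I)
        = Complex.exp ((((Complex.log (z₂ q / ζ)).im + ζ.arg : ℝ) : ℂ) * Complex.I) := by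
      push_cast
      rw [Complex.log_im, add_mul, Complex.exp_add]
      have e2 : ∀ z : ℂ, z ≠ 0 → Complex.exp (z.arg * Complex.I) = z / ‖z‖ := by
        intro z hz
        have hz' : (‖z‖ : ℂ) ≠ 0 := by exact_mod_cast norm_ne_zero_iff.2 hz
        rw [eq_div_iff hz', mul_comm, Complex.norm_mul_exp_arg_mul_I]
      have n1 : (‖z₂ q‖ : ℂ) ≠ 0 := by exact_mod_cast norm_ne_zero_iff.2 hzq
      have n2 : (‖ζ‖ : ℂ) ≠ 0 := by exact_mod_cast norm_ne_zero_iff.2 hz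
      rw [e2 _ hzq, e2 _ hz, e2 _ (div_ne_zero hzq hz), norm_div]
      push_cast
      field_simp
    obtain ⟨n, hn⟩ := Complex.exp_eq_exp_iff_exists_int.1 hexp
    have hn' : (z₂ q).arg = (Complex.log (z₂ q / ζ)).im + ζ.arg + n * (2 * Real.pi) := by
      have h3 : ((z₂ q).arg : ℂ)
          = (((Complex.log (z₂ q / ζ)).im + ζ.arg + n * (2 * Real.pi) : ℝ) : ℂ) := by
        apply mul_right_cancel₀ Complex.I_ne_zero
        rw [hn]
        push_cast
        ring
      exact_mod_cast h3
    have hsn : (τ₁Inv q).2 = s q + n := by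
      simp only [τ₁Inv, hs, hn']
      have := Real.pi_ne_zero
      field_simp
    rw [hsn, hF.periodic_int]
  refine ContDiffAt.congr_of_eventuallyEq ?_ hev
  exact ContDiffAt.comp (g := fun q : ℝ × ℂ => F q.1 q.2) (p : R4) hF.smooth.contDiffAt
    (hsm.prodMk hxm)

/-- The denominator vanishes only on the circle `z₂ = 0`, and near this circle the numerator is
identically zero. -/
theorem contDiffAt_torusCoeff (hF : IsTorusFunction F r) (p : S3) :
    ContDiffAt ℝ ∞ (torusCoeff F) p := by
  rcases eq_or_ne (z₂ (p : R4)) 0 with h | h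
  · have hlt := hF.lt_sqrt_two_mul_norm_z₁ p (by rw [h, norm_zero]; exact norm_nonneg _)
    refine (contDiffAt_const (c := (0 : ℝ))).congr_of_eventuallyEq ?_
    filter_upwards [hF.torusExt_eventuallyEq_zero hlt] with q hq
    rw [torusCoeff, hq, zero_div]
  · have hz2 : ContDiff ℝ ∞ z₂ := by
      have := z₂L.contDiff (n := ∞)
      rwa [show (z₂L : R4 → ℂ) = z₂ from funext z₂L_apply] at this
    refine (hF.contDiffAt_torusExt p).div (contDiffAt_const.mul (hz2.norm_sq ℝ).contDiffAt) ?_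
    have : ‖z₂ (p : R4)‖ ≠ 0 := norm_ne_zero_iff.2 h
    positivity

theorem continuous_torusExt (hF : IsTorusFunction F r) : Continuous fun p : S3 => torusExt F p := by
  rw [continuous_iff_continuousAt]
  exact fun p => ContinuousAt.comp (f := fun q : S3 => (q : R4)) (x := p)
    (hF.contDiffAt_torusExt p).continuousAt continuous_subtype_val.continuousAt

theorem integral_torusExt (hF : IsTorusFunction F r) :
    ∫ p : S3, torusExt F p ∂(volume : Measure R4).toSphere
      = Real.pi * ∫ t in (0 : ℝ)..1, ∫ x, F t x := by
  rw [integral_solidTorus hF.continuous_torusExt fun p h => by rw [torusExt, if_neg (not_le.2 h)]]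
  congr 2
  funext t
  have h : ∫ x in Metric.closedBall (0 : ℂ) 1, F t x = ∫ x, F t x := by
    refine setIntegral_eq_integral_of_forall_compl_eq_zero fun x hx => ?_
    rw [mem_closedBall_zero_iff, not_le] at hx
    exact hF.support t x (hF.lt_one.le.trans hx.le)
  rw [← h]
  exact congrArg (fun g : ℂ → ℝ => ∫ x in Metric.closedBall (0 : ℂ) 1, g x)
    (funext fun x => hF.torusExt_τ₁ x t)

end IsTorusFunction

/-! ### The primitive -/

/-- The one-form `π (α + F₁ dt₁ + F₂ dt₂)`, where `α` is the standard contact form and `t₁`, `t₂`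
are the angular coordinates of the solid tori. -/
def primitive (F₁ F₂ : ℝ → ℂ → ℝ) (p : R4) : R4 →L[ℝ] ℝ :=
  (Real.pi + torusCoeff F₁ p) • (areaL (z₂ p)).comp z₂L
    + (Real.pi + torusCoeff F₂ (swapIso p)) • (areaL (z₁ p)).comp z₁L

theorem primitive_apply (F₁ F₂ : ℝ → ℂ → ℝ) (p v : R4) : primitive F₁ F₂ p v
    = (Real.pi + torusCoeff F₁ p) * areaForm (z₂ p) (z₂ v)
      + (Real.pi + torusCoeff F₂ (swapIso p)) * areaForm (z₁ p) (z₁ v) := by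
  simp [primitive, z₁L_apply, z₂L_apply]

theorem primitive_swap (F₁ F₂ : ℝ → ℂ → ℝ) (p v : R4) :
    primitive F₁ F₂ (swapIso p) (swapIso v) = primitive F₂ F₁ p v := by
  simp only [primitive_apply, swapIso_swapIso, z₁_swapIso, z₂_swapIso]
  ring

section Primitive

variable {F₁ F₂ : ℝ → ℂ → ℝ} {r₁ r₂ : ℝ}

theorem contDiffAt_primitive (h₁ : IsTorusFunction F₁ r₁) (h₂ : IsTorusFunction F₂ r₂) (p : S3) :
    ContDiffAt ℝ ∞ (primitive F₁ F₂) p := by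
  have ha : ∀ (L M : R4 →L[ℝ] ℂ), ContDiff ℝ ∞ fun q : R4 => (areaL (L q)).comp M := fun L M =>
    (areaLL.contDiff.comp L.contDiff).clm_comp contDiff_const
  have ha1 := ha z₁L z₁L
  have ha2 := ha z₂L z₂L
  simp only [z₁L_apply] at ha1
  simp only [z₂L_apply] at ha2
  have hs : ContDiffAt ℝ ∞ (fun q => torusCoeff F₂ (swapIso q)) p :=
    ContDiffAt.comp (g := torusCoeff F₂) (p : R4)
      (h₂.contDiffAt_torusCoeff (sphereMap swapIso p)) swapIso.contDiff.contDiffAt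
  exact ((contDiffAt_const.add (h₁.contDiffAt_torusCoeff p)).smul ha2.contDiffAt).add
    ((contDiffAt_const.add hs).smul ha1.contDiffAt)

/-- The bound on `‖x‖` is exactly where `√2 ‖z₂‖ > r₂`, so the second Hamiltonian does not
contribute. The region extends past the unit disk, so the formula can be differentiated at boundary
points too. -/
theorem primitive_fderiv_τ₁ (h₁ : IsTorusFunction F₁ r₁) (h₂ : IsTorusFunction F₂ r₂) {x : ℂ}
    (hx : ‖x‖ ^ 2 < 2 - r₂ ^ 2) (t : ℝ) (w : ℂ × ℝ) :
    primitive F₁ F₂ (τ₁ (x, t)) (fderiv ℝ τ₁ (x, t) w)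
      = Real.pi * (areaForm x w.1 / 2 + (2 * Real.pi + F₁ t x) * w.2) := by
  have hx2 : ‖x‖ ^ 2 < 2 := by nlinarith [h₂.pos]
  have h0 : 0 < 1 - ‖x‖ ^ 2 / 2 := by linarith
  have hS := Real.sqrt_pos.2 h0
  have hS2 := Real.sq_sqrt h0.le
  have h2 : Real.sqrt 2 ^ 2 = 2 := Real.sq_sqrt (by norm_num)
  have h20 : Real.sqrt 2 ≠ 0 := (Real.sqrt_pos.2 (by norm_num)).ne'
  have hz : torusCoeff F₂ (swapIso (τ₁ (x, t))) = 0 := by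
    rw [torusCoeff, h₂.torusExt_eq_zero, zero_div]
    rw [z₁_swapIso, z₂_τ₁, norm_big, ← pow_le_pow_iff_left₀ h₂.pos.le (by positivity) two_ne_zero,
      mul_pow, hS2, h2]
    linarith
  have hc : torusCoeff F₁ (τ₁ (x, t)) = F₁ t x / (2 * Real.sqrt (1 - ‖x‖ ^ 2 / 2) ^ 2) := by
    rw [torusCoeff, h₁.torusExt_τ₁, z₂_τ₁, norm_big]
  rw [primitive_apply, hz, hc, z₁_fderiv_τ₁ hx2, z₂_fderiv_τ₁ hx2, z₁_τ₁, z₂_τ₁,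
    areaForm_rot (norm_rot t), areaForm_rot (norm_rot t)]
  generalize Real.sqrt (1 - ‖x‖ ^ 2 / 2) = S at hS hS2 ⊢
  rw [norm_sq_complex] at hS2
  simp only [areaForm]
  simp
  field_simp
  rw [hS2, h2]
  ring

/-- Naturality of `d`: the pullback of the primitive by `τ₁` is `π (λ + (2π + F₁) dt)` near `(x,
t)`, with differential `π (ω + dF₁ ∧ dt)`. -/
theorem extDeriv_primitive_τ₁ (h₁ : IsTorusFunction F₁ r₁) (h₂ : IsTorusFunction F₂ r₂) {x : ℂ}
    (hx : ‖x‖ ≤ 1) (t : ℝ) (v w : ℂ × ℝ) :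
    extDeriv (fun q => oneForm (primitive F₁ F₂ q)) (τ₁ (x, t))
        ![fderiv ℝ τ₁ (x, t) v, fderiv ℝ τ₁ (x, t) w]
      = Real.pi * (areaForm v.1 w.1 + areaForm (hamVF (F₁ t) x) v.1 * w.2
        - areaForm (hamVF (F₁ t) x) w.1 * v.2) := by
  have hx1 : ‖x‖ ^ 2 ≤ 1 := pow_le_one₀ (norm_nonneg x) hx
  have hx2 : ‖x‖ ^ 2 < 2 := by linarith
  have hxr : ‖x‖ ^ 2 < 2 - r₂ ^ 2 := by nlinarith [h₂.pos, h₂.lt_one]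
  set p : S3 := ⟨τ₁ (x, t), mem_sphere_zero_iff_norm.2 (norm_τ₁ hx2.le t)⟩ with hp
  have hB : DifferentiableAt ℝ (primitive F₁ F₂) (τ₁ (x, t)) :=
    (contDiffAt_primitive h₁ h₂ p).differentiableAt (by simp)
  have hd : DifferentiableAt ℝ (fun q => (oneForm (primitive F₁ F₂ q) : R4 [⋀^Fin 1]→L[ℝ] ℝ))
      (τ₁ (x, t)) := (oneForm (E := R4)).differentiable.differentiableAt.comp _ hB
  have hpull := extDeriv_pullback (r := ∞) hd (contDiffAt_τ₁ hx2 t)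
    (by simp; exact WithTop.coe_le_coe.2 le_top)
  set P : ℂ × ℝ → (ℂ × ℝ →L[ℝ] ℝ) := fun q =>
    (Real.pi / 2) • (areaL q.1).comp (.fst ℝ ℂ ℝ)
      + (Real.pi * (2 * Real.pi + F₁ q.2 q.1)) • (.snd ℝ ℂ ℝ) with hP
  have hev : (fun q => (oneForm (primitive F₁ F₂ (τ₁ q))).compContinuousLinearMap (fderiv ℝ τ₁ q))
      =ᶠ[nhds (x, t)] fun q => oneForm (P q) := by
    have hop : ∀ᶠ q in nhds (x, t), ‖q.1‖ ^ 2 < 2 - r₂ ^ 2 :=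
      (isOpen_lt (continuous_fst.norm.pow 2) continuous_const).mem_nhds hxr
    filter_upwards [hop] with q hq
    ext w
    have := primitive_fderiv_τ₁ h₁ h₂ hq q.2 (w 0)
    simp only [Prod.mk.eta] at this
    simp only [ContinuousAlternatingMap.compContinuousLinearMap_apply, oneForm_apply,
      Function.comp_apply, this, hP]
    simp
    ring
  have hFs : ContDiff ℝ ∞ fun q : ℂ × ℝ => F₁ q.2 q.1 :=
    h₁.smooth.comp (contDiff_snd.prodMk contDiff_fst)
  have hFd : HasFDerivAt (fun q : ℂ × ℝ => F₁ q.2 q.1) _ (x, t) :=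
    (hFs.differentiable (by simp) (x, t)).hasFDerivAt
  have hPd : HasFDerivAt P ((Real.pi / 2) • ((ContinuousLinearMap.compL ℝ (ℂ × ℝ) ℂ ℝ).flip
      (.fst ℝ ℂ ℝ)).comp (areaLL.comp (.fst ℝ ℂ ℝ))
      + (Real.pi • fderiv ℝ (fun q : ℂ × ℝ => F₁ q.2 q.1) (x, t)).smulRight
        (ContinuousLinearMap.snd ℝ ℂ ℝ)) (x, t) := by
    refine HasFDerivAt.add ?_ ?_
    · exact ContinuousLinearMap.hasFDerivAt ((Real.pi / 2) •
        ((ContinuousLinearMap.compL ℝ (ℂ × ℝ) ℂ ℝ).flip (.fst ℝ ℂ ℝ)).comp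
          (areaLL.comp (.fst ℝ ℂ ℝ)))
    · exact HasFDerivAt.smul_const (𝕜 := ℝ) (𝕜' := ℝ)
        ((hFd.const_add (2 * Real.pi)).const_mul Real.pi) (ContinuousLinearMap.snd ℝ ℂ ℝ)
  have hslice : ∀ u : ℂ, fderiv ℝ (fun q : ℂ × ℝ => F₁ q.2 q.1) (x, t) (u, 0)
      = areaForm (hamVF (F₁ t) x) u := by
    intro u
    rw [areaForm_hamVF]
    have := hFd.comp x (hasFDerivAt_prodMk_left (𝕜 := ℝ) x t)
    have h3 : fderiv ℝ (F₁ t) x = _ := this.fderiv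
    rw [h3]
    simp
  -- The time derivative of `F₁` is split off; it cancels on antisymmetrization, since `dt ∧ dt =
  -- 0`.
  have hsplit : ∀ u : ℂ × ℝ, fderiv ℝ (fun q : ℂ × ℝ => F₁ q.2 q.1) (x, t) u
      = areaForm (hamVF (F₁ t) x) u.1
        + u.2 * fderiv ℝ (fun q : ℂ × ℝ => F₁ q.2 q.1) (x, t) (0, 1) := by
    intro u
    rw [← hslice, ← smul_eq_mul, ← map_smul, ← map_add]
    simp
  have h4 : extDeriv (fun q => oneForm (P q)) (x, t) ![v, w] = _ :=
    extDeriv_oneForm hPd.differentiableAt v w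
  rw [← hev.extDeriv_eq, hpull, hPd.fderiv] at h4
  have h5 : (extDeriv (fun q => oneForm (primitive F₁ F₂ q)) (τ₁ (x, t))).compContinuousLinearMap
      (fderiv ℝ τ₁ (x, t)) ![v, w] = extDeriv (fun q => oneForm (primitive F₁ F₂ q)) (τ₁ (x, t))
        ![fderiv ℝ τ₁ (x, t) v, fderiv ℝ τ₁ (x, t) w] := by
    rw [ContinuousAlternatingMap.compContinuousLinearMap_apply]
    congr 1
    funext i
    fin_cases i <;> rfl
  rw [← h5, h4]
  simp only [add_apply, smul_apply,
    ContinuousLinearMap.comp_apply, ContinuousLinearMap.flip_apply, ContinuousLinearMap.compL_apply,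
    ContinuousLinearMap.smulRight_apply, ContinuousLinearMap.coe_fst', ContinuousLinearMap.coe_snd',
    areaLL_apply, areaL_apply, smul_eq_mul]
  rw [hsplit v, hsplit w, areaForm_swap w.1 v.1]
  ring

end Primitive

/-! ### The helicity of the double suspension -/

theorem HamiltonianIsotopy.exists_isTorusFunction (Φ : HamiltonianIsotopy) (h : Φ.IsOnePeriodic) :
    ∃ r, IsTorusFunction Φ.F r ∧ IsTorusFunction Φ.lagrangian r := by
  obtain ⟨r, h0, h1, hr⟩ := Φ.exists_support
  refine ⟨r, ⟨Φ.smooth_F, h, h0, h1, fun t x hx => (hr t x hx).1⟩,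
    ⟨Φ.contDiff_lagrangian, fun t x => ?_, h0, h1, fun t x hx => (hr t x hx).2.2⟩⟩
  simp only [lagrangian, show Φ.F (t + 1) = Φ.F t from funext (h t)]

theorem sphereMap_swapIso_swapIso (p : S3) : sphereMap swapIso (sphereMap swapIso p) = p :=
  Subtype.ext (swapIso_swapIso p)

/-- It rests on `τ₂ = swapIso ∘ τ₁`. On the common boundary torus the push-forward formulas hold for
both parametrizations, so the case distinction in the definition does no harm. -/
theorem doubleSuspension_swapIso {Φ₁ Φ₂ : HamiltonianIsotopy} (h₁ : Φ₁.IsOnePeriodic)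
    (h₂ : Φ₂.IsOnePeriodic) (p : S3) : doubleSuspension Φ₁ Φ₂ (sphereMap swapIso p)
      = swapIso (doubleSuspension Φ₂ Φ₁ p) := by
  have key : ∀ {Φ Ψ : HamiltonianIsotopy}, Ψ.IsOnePeriodic → ∀ p : S3,
      ‖z₁ (p : R4)‖ ≤ ‖z₂ (p : R4)‖ →
      doubleSuspension Φ Ψ (sphereMap swapIso p) = swapIso (doubleSuspension Ψ Φ p) := by
    intro Φ Ψ hΨ p hp
    obtain ⟨x, t, hx, hpx⟩ := exists_eq_τ₁ p hp
    have hs : (sphereMap swapIso p : R4) = τ₂ (x, t) := congrArg swapIso hpx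
    rw [doubleSuspension_τ₁ Ψ Φ hΨ hx t p hpx, doubleSuspension_τ₂ Φ Ψ hΨ hx t _ hs, fderiv_τ₂]
  rcases le_total ‖z₁ (p : R4)‖ ‖z₂ (p : R4)‖ with hp | hp
  · exact key h₂ p hp
  · have := key (Φ := Φ₂) h₁ (sphereMap swapIso p) hp
    rw [sphereMap_swapIso_swapIso] at this
    rw [this, swapIso_swapIso]

theorem inner_doubleSuspension {Φ₁ Φ₂ : HamiltonianIsotopy} (h₁ : Φ₁.IsOnePeriodic)
    (h₂ : Φ₂.IsOnePeriodic) (p : S3) : inner ℝ (p : R4) (doubleSuspension Φ₁ Φ₂ p) = 0 := by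
  have key : ∀ {Φ Ψ : HamiltonianIsotopy}, Φ.IsOnePeriodic → ∀ p : S3,
      ‖z₁ (p : R4)‖ ≤ ‖z₂ (p : R4)‖ → inner ℝ (p : R4) (doubleSuspension Φ Ψ p) = 0 := by
    intro Φ Ψ hΦ p hp
    obtain ⟨x, t, hx, hpx⟩ := exists_eq_τ₁ p hp
    rw [doubleSuspension_τ₁ Φ Ψ hΦ hx t p hpx, hpx]
    exact fderiv_τ₁_tangent (by nlinarith [norm_nonneg x]) t _
  rcases le_total ‖z₁ (p : R4)‖ ‖z₂ (p : R4)‖ with hp | hp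
  · exact key h₁ p hp
  · have h := key (Ψ := Φ₁) h₂ (sphereMap swapIso p) hp
    rwa [doubleSuspension_swapIso h₂ h₁, show (sphereMap swapIso p : R4) = swapIso p from rfl,
      LinearIsometryEquiv.inner_map_map] at h

theorem extDeriv_primitive_swapIso {F₁ F₂ : ℝ → ℂ → ℝ} {r₁ r₂ : ℝ} (h₁ : IsTorusFunction F₁ r₁)
    (h₂ : IsTorusFunction F₂ r₂) (p : S3) (v w : R4) :
    extDeriv (fun q => oneForm (primitive F₁ F₂ q)) (swapIso p) ![swapIso v, swapIso w]
      = extDeriv (fun q => oneForm (primitive F₂ F₁ q)) p ![v, w] := by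
  have hB : DifferentiableAt ℝ (primitive F₁ F₂) (swapIso p) :=
    (contDiffAt_primitive h₁ h₂ (sphereMap swapIso p)).differentiableAt (by simp)
  let S : R4 →L[ℝ] R4 := swapIso.toContinuousLinearEquiv
  let K : (R4 →L[ℝ] ℝ) →L[ℝ] R4 →L[ℝ] ℝ := (ContinuousLinearMap.compL ℝ R4 R4 ℝ).flip S
  have hcomp : primitive F₂ F₁ = fun q => K (primitive F₁ F₂ (S q)) := by
    funext q
    ext v
    exact (primitive_swap F₁ F₂ q v).symm
  have hd : HasFDerivAt (primitive F₂ F₁)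
      (K.comp ((fderiv ℝ (primitive F₁ F₂) (swapIso p)).comp S)) (p : R4) := by
    rw [hcomp]
    exact K.hasFDerivAt.comp (p : R4) (hB.hasFDerivAt.comp (p : R4) S.hasFDerivAt)
  rw [extDeriv_oneForm hB, extDeriv_oneForm hd.differentiableAt, hd.fderiv]
  rfl

theorem isPrimitive_primitive {Φ₁ Φ₂ : HamiltonianIsotopy} (h₁ : Φ₁.IsOnePeriodic)
    (h₂ : Φ₂.IsOnePeriodic) :
    IsPrimitive (doubleSuspension Φ₁ Φ₂) fun q => oneForm (primitive Φ₁.F Φ₂.F q) := by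
  obtain ⟨r₁, hF₁, -⟩ := Φ₁.exists_isTorusFunction h₁
  obtain ⟨r₂, hF₂, -⟩ := Φ₂.exists_isTorusFunction h₂
  -- The identity on the first solid torus, for an arbitrary pair of isotopies, so that the exchange
  -- of coordinates also yields the second. Tangent vectors are written as images under `fderiv ℝ
  -- τ₁`, where both sides are explicit.
  have key : ∀ {Φ Ψ : HamiltonianIsotopy} {r s : ℝ}, Φ.IsOnePeriodic → IsTorusFunction Φ.F r →
      IsTorusFunction Ψ.F s → ∀ (p : S3) (v w : R4), ‖z₁ (p : R4)‖ ≤ ‖z₂ (p : R4)‖ →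
      inner ℝ (p : R4) v = 0 → inner ℝ (p : R4) w = 0 →
      extDeriv (fun q => oneForm (primitive Φ.F Ψ.F q)) p ![v, w]
        = dV p (doubleSuspension Φ Ψ p) v w := by
    intro Φ Ψ r s hΦ hF hG p v w hp hv hw
    obtain ⟨x, t, hx, hpx⟩ := exists_eq_τ₁ p hp
    have hx2 : ‖x‖ ^ 2 < 2 := by nlinarith [norm_nonneg x]
    rw [doubleSuspension_τ₁ Φ Ψ hΦ hx t p hpx]
    rw [hpx] at hv hw ⊢
    obtain ⟨v, rfl⟩ := exists_fderiv_τ₁_eq hx2 t hv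
    obtain ⟨w, rfl⟩ := exists_fderiv_τ₁_eq hx2 t hw
    rw [extDeriv_primitive_τ₁ hF hG hx, dV_fderiv_τ₁ hx2, HamiltonianIsotopy.suspension]
    ring
  refine ⟨fun p => (oneForm (E := R4)).contDiff.contDiffAt.comp (p : R4)
    (contDiffAt_primitive hF₁ hF₂ p), fun p v w hv hw => ?_⟩
  rcases le_total ‖z₁ (p : R4)‖ ‖z₂ (p : R4)‖ with hp | hp
  · exact key h₁ hF₁ hF₂ p v w hp hv hw
  · have h := key h₂ hF₂ hF₁ (sphereMap swapIso p) (swapIso v) (swapIso w) hp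
      (by rwa [← LinearIsometryEquiv.inner_map_map swapIso] at hv)
      (by rwa [← LinearIsometryEquiv.inner_map_map swapIso] at hw)
    rwa [doubleSuspension_swapIso h₂ h₁, show (sphereMap swapIso p : R4) = swapIso p from rfl,
      extDeriv_primitive_swapIso hF₂ hF₁, dV_swapIso] at h

/-! ### Evaluation of the helicity integral -/

/-- On the first solid torus `β(X) = π (λ(X_F) + 2π + F)`. Extension of both Lagrangians by zero
gives a single formula on the sphere, which can be integrated term by term. -/
theorem primitive_doubleSuspension {Φ₁ Φ₂ : HamiltonianIsotopy} (h₁ : Φ₁.IsOnePeriodic)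
    (h₂ : Φ₂.IsOnePeriodic) (p : S3) : primitive Φ₁.F Φ₂.F p (doubleSuspension Φ₁ Φ₂ p)
      = 2 * Real.pi ^ 2 + (Real.pi * torusExt Φ₁.lagrangian p
        + Real.pi * torusExt Φ₂.lagrangian (sphereMap swapIso p)) := by
  obtain ⟨r₁, hF₁, hL₁⟩ := Φ₁.exists_isTorusFunction h₁
  obtain ⟨r₂, hF₂, hL₂⟩ := Φ₂.exists_isTorusFunction h₂
  have key : ∀ {Φ Ψ : HamiltonianIsotopy} {r s : ℝ}, Φ.IsOnePeriodic → IsTorusFunction Φ.F r →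
      IsTorusFunction Ψ.F s → IsTorusFunction Φ.lagrangian r → IsTorusFunction Ψ.lagrangian s →
      ∀ p : S3, ‖z₁ (p : R4)‖ ≤ ‖z₂ (p : R4)‖ →
      primitive Φ.F Ψ.F p (doubleSuspension Φ Ψ p) = 2 * Real.pi ^ 2
        + (Real.pi * torusExt Φ.lagrangian p
          + Real.pi * torusExt Ψ.lagrangian (sphereMap swapIso p)) := by
    intro Φ Ψ r s hΦ hF hG hL hM p hp
    rw [hM.torusExt_eq_zero (hM.lt_sqrt_two_mul_norm_z₁ (sphereMap swapIso p) hp).le]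
    obtain ⟨x, t, hx, hpx⟩ := exists_eq_τ₁ p hp
    have hx2 : ‖x‖ ^ 2 < 2 - s ^ 2 := by nlinarith [norm_nonneg x, hG.pos, hG.lt_one]
    rw [doubleSuspension_τ₁ Φ Ψ hΦ hx t p hpx, hpx, primitive_fderiv_τ₁ hF hG hx2,
      hL.torusExt_τ₁]
    simp only [HamiltonianIsotopy.suspension, HamiltonianIsotopy.lagrangian]
    ring
  rcases le_total ‖z₁ (p : R4)‖ ‖z₂ (p : R4)‖ with hp | hp
  · exact key h₁ hF₁ hF₂ hL₁ hL₂ p hp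
  · have h := key h₂ hF₂ hF₁ hL₂ hL₁ (sphereMap swapIso p) hp
    rw [doubleSuspension_swapIso h₂ h₁, sphereMap_swapIso_swapIso,
      show (sphereMap swapIso p : R4) = swapIso p from rfl, primitive_swap] at h
    rw [h, show (sphereMap swapIso p : R4) = swapIso p from rfl]
    ring

theorem HamiltonianIsotopy.integral_torusExt_lagrangian (Φ : HamiltonianIsotopy)
    (h : Φ.IsOnePeriodic) : ∫ p : S3, torusExt Φ.lagrangian p ∂(volume : Measure R4).toSphere
      = 2 * Real.pi * Φ.hamIntegral := by
  obtain ⟨r, -, hL⟩ := Φ.exists_isTorusFunction h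
  simp only [hL.integral_torusExt, Φ.integral_lagrangian, HamiltonianIsotopy.hamIntegral,
    Φ.setIntegral_closedBall_F, intervalIntegral.integral_const_mul]
  ring

theorem integralS3_wedgeD_primitive {Φ₁ Φ₂ : HamiltonianIsotopy} (h₁ : Φ₁.IsOnePeriodic)
    (h₂ : Φ₂.IsOnePeriodic) :
    integralS3 (wedgeD fun q => oneForm (primitive Φ₁.F Φ₂.F q))
      = 2 * Real.pi ^ 2 * (Φ₁.hamIntegral + Φ₂.hamIntegral + 2 * Real.pi ^ 2) := by
  obtain ⟨r₁, -, hL₁⟩ := Φ₁.exists_isTorusFunction h₁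
  obtain ⟨r₂, -, hL₂⟩ := Φ₂.exists_isTorusFunction h₂
  have hint : ∀ g : S3 → ℝ, Continuous g → Integrable g (volume : Measure R4).toSphere :=
    fun g hg => hg.integrable_of_hasCompactSupport (HasCompactSupport.of_compactSpace g)
  have hi₁ := hint (fun p => Real.pi * torusExt Φ₁.lagrangian p)
    (hL₁.continuous_torusExt.const_mul Real.pi)
  have hi₂ := hint (fun p => Real.pi * torusExt Φ₂.lagrangian (sphereMap swapIso p))
    ((hL₂.continuous_torusExt.comp (continuous_sphereMap swapIso)).const_mul Real.pi)
  simp only [integralS3, wedgeD_frame (isPrimitive_primitive h₁ h₂) (inner_doubleSuspension h₁ h₂),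
    oneForm_apply, Matrix.cons_val_zero, primitive_doubleSuspension h₁ h₂]
  rw [integral_add (g := fun p : S3 => Real.pi * torusExt Φ₁.lagrangian p
    + Real.pi * torusExt Φ₂.lagrangian (sphereMap swapIso p)) (integrable_const _) (hi₁.add hi₂),
    integral_add hi₁ hi₂, integral_const,
    integral_const_mul, integral_const_mul, toSphere_real_univ,
    integral_sphereMap swapIso fun p => torusExt Φ₂.lagrangian p,
    Φ₁.integral_torusExt_lagrangian h₁, Φ₂.integral_torusExt_lagrangian h₂, smul_eq_mul]
  ring

end DoubleSuspension

end

theorem theorem1p3 (Φ₁ Φ₂ : DoubleSuspension.HamiltonianIsotopy)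
    (h₁ : Φ₁.IsOnePeriodic) (h₂ : Φ₂.IsOnePeriodic) :
    DoubleSuspension.HasHelicity (DoubleSuspension.doubleSuspension Φ₁ Φ₂)
      (2 * Real.pi ^ 2 *
        (DoubleSuspension.calabi Φ₁.timeOne + DoubleSuspension.calabi Φ₂.timeOne
          + 2 * Real.pi ^ 2)) where
  tangent := DoubleSuspension.inner_doubleSuspension h₁ h₂
  exact := ⟨_, DoubleSuspension.isPrimitive_primitive h₁ h₂⟩
  helicity_eq β hβ := by
    rw [Φ₁.calabi_timeOne, Φ₂.calabi_timeOne,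
      DoubleSuspension.integralS3_wedgeD_congr hβ (DoubleSuspension.isPrimitive_primitive h₁ h₂),
      DoubleSuspension.integralS3_wedgeD_primitive h₁ h₂]
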